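/- Work in ZFC. A game of length $\omega_1$ on integers with payoff set $A\subseteq\omega^{\omega_1}$ is the perfect information game in which two players together build a sequence $x\in\omega^{\omega_1}$: the move $x(\alpha)$ is made by the first player if $\alpha$ is even (that is, $\alpha=\omega\cdot\beta+2n$ for an ordinal $\beta$ and an $n<\omega$; in particular if $\alpha$ is $0$ or a limit) and by the second player otherwise, each move being made with knowledge of all earlier moves; the first player wins if and only if $x\in A$. The game is determined if one of the players has a winning strategy. The set $A$ is ordinal definable if there are an ordinal $\theta>\omega_1$, a formula $\psi$ of the language of set theory and finitely many ordinals $a_1,\dots,a_n<\theta$ such that $A=\{x\in\omega^{\omega_1} : V_\theta\models\psi(x,a_1,\dots,a_n)\}$. Theorem. Assume that every game of length $\omega_1$ on integers with ordinal definable payoff set is determined. Let $\delta>\omega_1$ be an ordinal and let $r$ be a real number (an element of $\omega^\omega$). Then there is a function $f$ from countable sequences of Turing degrees (sequences of length less than $\omega_1$) to Turing degrees such that for every first-order formula $\varphi$ of the language of set theory with two free variables, the truth of $\varphi(r,S)$ in $V_\delta$ is the same for all sequences $S$ of Turing degrees of length $\omega_1$ that satisfy $f(S|\alpha)\le S(\alpha)$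 for every $\alpha<\omega_1$. Here $S|\alpha$ is the restriction of $S$ to $\alpha$, $\le$ is the ordering of Turing degrees by Turing reducibility, and a Turing degree is a class of Turing equivalent reals. -/

import Mathlib

universe u

namespace LongGame

/-! ### Reals and Turing degrees -/

/-- Reals, as elements of Baire space. -/
def Baire : Type := ℕ → ℕ

/-- Reals are preordered by Turing reducibility. -/
instance : Preorder Baire where
  le x y := TuringReducible (fun n => Part.some (x n)) (fun n => Part.some (y n))
  le_refl x := TuringReducible.refl _
  le_trans _ _ _ := TuringReducible.trans

/-- Turing degrees: classes of reals under Turing equivalence, partially ordered by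
Turing reducibility of representatives. (Mathlib's `TuringDegree` also has degrees of
properly partial functions, so it is not used here.) -/
abbrev Degree : Type := Antisymmetrization Baire (· ≤ ·)

/-- The Turing degree of a real. -/
def degree (x : Baire) : Degree := toAntisymmetrization (· ≤ ·) x

/-! ### Sequences of length `ω₁` and countable sequences -/

/-- The first uncountable ordinal. -/
noncomputable abbrev omegaOne : Ordinal.{u} := Ordinal.omega 1

/-- Sequences of length `ω₁`. -/
abbrev LongSeq (β : Type) : Type (u + 1) := Set.Iio omegaOne.{u} → β

/-- Countable sequences: a length `α < ω₁` together with a function on `{γ | γ < α}`. -/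
abbrev CountableSeq (β : Type) : Type (u + 1) :=
  Σ α : Set.Iio omegaOne.{u}, (Set.Iio α.1 → β)

/-- The initial segment `s|α`. -/
def LongSeq.restrict {β : Type} (s : LongSeq.{u} β) (α : Set.Iio omegaOne.{u}) :
    CountableSeq.{u} β :=
  ⟨α, fun γ => s ⟨γ.1, lt_trans (Set.mem_Iio.1 γ.2) (Set.mem_Iio.1 α.2)⟩⟩

/-! ### Coding as elements of the universe of sets -/

/-- A natural number as a von Neumann ordinal. -/
noncomputable def natCode (n : ℕ) : ZFSet.{u} := (n : Ordinal.{u}).toZFSet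

/-- A real as a set of ordered pairs. -/
noncomputable def realCode (x : Baire) : ZFSet.{u} :=
  ZFSet.range fun n : ℕ => ZFSet.pair (natCode n) (natCode (x n))

/-- A Turing degree as the set of its elements. -/
noncomputable def degreeCode (d : Degree) : ZFSet.{u} :=
  ZFSet.range fun x : {x : Baire // degree x = d} => realCode x.1

/-- The sequence with terms coded by `c`, as a set of ordered pairs. -/
noncomputable def seqCode {β : Type} (c : β → ZFSet.{u}) (s : LongSeq.{u} β) : ZFSet.{u} :=
  ZFSet.range fun α : Set.Iio omegaOne.{u} => ZFSet.pair α.1.toZFSet (c (s α))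

theorem rank_pair_lt {o : Ordinal.{u}} (ho : Order.IsSuccLimit o) {x y : ZFSet.{u}}
    (hx : x.rank < o) (hy : y.rank < o) : (ZFSet.pair x y).rank < o := by
  have h : ∀ a b : ZFSet.{u}, a.rank < o → b.rank < o → ({a, b} : ZFSet.{u}).rank < o := by
    intro a b ha hb
    rw [ZFSet.rank_pair]
    exact max_lt (ho.succ_lt ha) (ho.succ_lt hb)
  have h1 : ({x} : ZFSet.{u}).rank < o := by
    rw [← ZFSet.pair_eq_singleton]; exact h x x hx hx
  exact h _ _ h1 (h x y hx hy)

theorem omegaOne_isSuccLimit : Order.IsSuccLimit omegaOne.{u} := by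
  rw [omegaOne, ← Cardinal.ord_aleph]
  exact Cardinal.isSuccLimit_ord (Cardinal.aleph0_le_aleph 1)

theorem rank_natCode_lt (n : ℕ) : (natCode.{u} n).rank < Ordinal.omega0 := by
  simp [natCode]

theorem rank_realCode_le (x : Baire) : (realCode.{u} x).rank ≤ Ordinal.omega0 := by
  rw [ZFSet.rank_le_iff]
  intro y hy
  obtain ⟨n, rfl⟩ := ZFSet.mem_range.1 hy
  exact rank_pair_lt Ordinal.isSuccLimit_omega0 (rank_natCode_lt _) (rank_natCode_lt _)

theorem omega0_lt_omegaOne : Ordinal.omega0 < omegaOne.{u} := by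
  rw [← Ordinal.omega_zero]
  exact Ordinal.omega_lt_omega.2 zero_lt_one

theorem rank_degreeCode_lt (d : Degree) : (degreeCode.{u} d).rank < omegaOne := by
  refine lt_of_le_of_lt (b := Order.succ Ordinal.omega0) ?_
    (omegaOne_isSuccLimit.succ_lt omega0_lt_omegaOne)
  rw [ZFSet.rank_le_iff]
  intro y hy
  obtain ⟨x, rfl⟩ := ZFSet.mem_range.1 hy
  exact Order.lt_succ_of_le (rank_realCode_le _)

theorem rank_seqCode_le {β : Type} {c : β → ZFSet.{u}} (hc : ∀ b, (c b).rank < omegaOne)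
    (s : LongSeq.{u} β) : (seqCode c s).rank ≤ omegaOne := by
  rw [ZFSet.rank_le_iff]
  intro y hy
  obtain ⟨α, rfl⟩ := ZFSet.mem_range.1 hy
  refine rank_pair_lt omegaOne_isSuccLimit ?_ (hc _)
  rw [Ordinal.rank_toZFSet]
  exact α.2

/-! ### First-order formulas of set theory and their truth in `V_θ` -/

/-- The only nonlogical symbol of set theory: binary membership. -/
inductive MemSymbol : ℕ → Type
  | mem : MemSymbol 2

/-- The first-order language of set theory (with equality as a logical symbol). -/
def setLanguage : FirstOrder.Language.{0, 0} := ⟨fun _ => Empty, MemSymbol⟩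

/-- `V_θ`, as a type. -/
abbrev Level (θ : Ordinal.{u}) : Type (u + 1) := {x : ZFSet.{u} // x ∈ ZFSet.vonNeumann θ}

/-- `V_θ` is a structure with the true membership relation. -/
instance (θ : Ordinal.{u}) : setLanguage.Structure (Level θ) where
  funMap := fun f _ => Empty.elim f
  RelMap := fun R => match R with
    | MemSymbol.mem => fun v => (v 0).1 ∈ (v 1).1

/-- An ordinal below `θ`, as an element of `V_θ`. -/
noncomputable def Level.ordinal {θ : Ordinal.{u}} (a : Set.Iio θ) : Level θ :=
  ⟨a.1.toZFSet, by rw [ZFSet.mem_vonNeumann, Ordinal.rank_toZFSet]; exact a.2⟩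

/-- A real, as an element of `V_θ`. -/
noncomputable def Level.real {θ : Ordinal.{u}} (hθ : omegaOne < θ) (x : Baire) : Level θ :=
  ⟨realCode x, ZFSet.mem_vonNeumann.2
    ((rank_realCode_le x).trans_lt (omega0_lt_omegaOne.trans hθ))⟩

/-- A sequence of natural numbers of length `ω₁`, as an element of `V_θ`. -/
noncomputable def Level.natSeq {θ : Ordinal.{u}} (hθ : omegaOne < θ) (x : LongSeq.{u} ℕ) :
    Level θ :=
  ⟨seqCode natCode x, ZFSet.mem_vonNeumann.2
    ((rank_seqCode_le (fun n => (rank_natCode_lt n).trans omega0_lt_omegaOne) x).trans_lt hθ)⟩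

/-- A sequence of Turing degrees of length `ω₁`, as an element of `V_θ`. -/
noncomputable def Level.degreeSeq {θ : Ordinal.{u}} (hθ : omegaOne < θ)
    (S : LongSeq.{u} Degree) : Level θ :=
  ⟨seqCode degreeCode S, ZFSet.mem_vonNeumann.2
    ((rank_seqCode_le rank_degreeCode_lt S).trans_lt hθ)⟩

/-- A set `A` of `ω₁`-sequences of natural numbers is ordinal definable: for some ordinal `θ`,
some formula and finitely many ordinals `a i < θ`, it consists of those sequences `x`
for which `V_θ` satisfies the formula at `x` and the `a i`. (The sequences have rank `ω₁`,
so that they belong to `V_θ` exactly when `ω₁ < θ`.) -/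
def OrdinalDefinable (A : Set (LongSeq.{u} ℕ)) : Prop :=
  ∃ (θ : Ordinal.{u}) (hθ : omegaOne < θ) (n : ℕ) (a : Fin n → Set.Iio θ)
    (φ : setLanguage.Formula (Fin (n + 1))),
    ∀ x : LongSeq.{u} ℕ,
      x ∈ A ↔ φ.Realize (Fin.cons (Level.natSeq hθ x) fun i => Level.ordinal (a i) :
        Fin (n + 1) → Level θ)

/-! ### Games of length `ω₁` -/

/-- Move number `α` belongs to the first player if `α` is even, that is `α = ω * β + 2 * n`
(in particular at limits), and to the second player otherwise. -/
def IsEven (α : Ordinal.{u}) : Prop :=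
  ∃ (β : Ordinal.{u}) (n : ℕ), α = Ordinal.omega0 * β + ((2 * n : ℕ) : Ordinal.{u})

/-- A strategy gives a move at every position. -/
abbrev Strategy : Type (u + 1) := CountableSeq.{u} ℕ → ℕ

/-- `x` is a play in which the first player follows `σ`. -/
def FollowsFirst (σ : Strategy.{u}) (x : LongSeq.{u} ℕ) : Prop :=
  ∀ α : Set.Iio omegaOne.{u}, IsEven α.1 → x α = σ (x.restrict α)

/-- `x` is a play in which the second player follows `τ`. -/
def FollowsSecond (τ : Strategy.{u}) (x : LongSeq.{u} ℕ) : Prop :=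
  ∀ α : Set.Iio omegaOne.{u}, ¬ IsEven α.1 → x α = τ (x.restrict α)

/-- The game of length `ω₁` on natural numbers in which the first player wins the play `x`
if and only if `x ∈ A` is determined: one of the players has a winning strategy. -/
def Determined (A : Set (LongSeq.{u} ℕ)) : Prop :=
  (∃ σ : Strategy.{u}, ∀ x, FollowsFirst σ x → x ∈ A) ∨
    (∃ τ : Strategy.{u}, ∀ x, FollowsSecond τ x → x ∉ A)

/-- `S` grows at least as fast as `f` prescribes: `f (S|α) ≤ S α` for all `α < ω₁`. -/
def GrowsFast (f : CountableSeq.{u} Degree → Degree) (S : LongSeq.{u} Degree) : Prop :=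
  ∀ α : Set.Iio omegaOne.{u}, f (S.restrict α) ≤ S α

end LongGame

-- Fix a formula `φ` and let two players play as follows. The first player's moves before `ω` spell
-- a real `x`; at move `ω + 1` the second player names a truth value (`0` for true); from `ω * 2`
-- on, every block of `ω` moves, made by both players, is a real, and the degrees of the blocks form
-- a sequence `S`. The second player wins if the named value is the truth value of `φ(x, S)` in
-- `V_δ` (`sidePayoff`). The real is played and not fixed in advance, so that no real parameter
-- enters the payoff.
--
-- The main point is `blockDegrees_play`: against a strategy of either player, every sequence `S`
-- that grows fast enough arises as the sequence of block degrees. The opponent plays into block `α`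
-- the terms of a representative `y` of `S α`. Since fixed representatives were played in the
-- earlier blocks, the replies are computed from `y` by a real that depends only on `S|α`
-- (`blockReply`). If `S α` bounds the degree of that real, the block is recursive in `y`; and `y`
-- is read off every other place of the block, so the block has the degree of `y`
-- (`degree_eq_of_interleave`).
--
-- Hence the first player has no winning strategy: two plays against it with the same `x` and the
-- same `S` can name opposite values. By determinacy the second player has one. When the first
-- player plays `r`, its answer at `ω + 1` comes before all the blocks, so it is the truth value of
-- `φ(r, S)` for all fast `S`. There are countably many formulas, and countably many degrees have an
-- upper bound (`exists_degree_upper_bound`), so one `f` serves all formulas.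
--
-- What remains is that the payoff is ordinal definable, by a formula over `V_δ` itself. As `δ` may
-- be `ω₁ + 1`, only sets of rank at most `ω₁` are available. They include all relations on natural
-- numbers and countable ordinals, so recursive notions can be expressed by quantifying over closed
-- sets: the pairing function, Turing reducibility (`turingReducible_iff_forall_closed`) and the
-- positions of the blocks (`blockStart_eq_iff`). The formulas themselves are assembled by instance
-- search.

universe v w w'

namespace LongGame

/-! ### Definability over `V_δ` -/

/-- An injective coding of the elements of a type by elements of `V_δ`. -/
class Coded (δ : Ordinal.{u}) (τ : Type v) where
  code : τ → Level δ
  code_injective : Function.Injective code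

/-- A type of assignments of elements of `V_δ` to finitely or infinitely many variables. -/
class Context (δ : Ordinal.{u}) (Γ : Type v) where
  Index : Type
  value : Γ → Index → Level δ

open Coded Context

instance (δ : Ordinal.{u}) : Context δ Unit := ⟨Empty, fun _ e => e.elim⟩

instance (δ : Ordinal.{u}) (Γ : Type v) (τ : Type w) [Context δ Γ] [Coded δ τ] :
    Context δ (Γ × τ) :=
  ⟨Index δ Γ ⊕ Unit, fun q => Sum.elim (value q.1) fun _ => code q.2⟩

instance (δ : Ordinal.{u}) : Coded δ (Level δ) := ⟨id, Function.injective_id⟩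

theorem omega0_add_one_lt_omegaOne : Ordinal.omega0 + 1 < omegaOne.{u} :=
  omegaOne_isSuccLimit.add_one_lt omega0_lt_omegaOne

/-- The ordinal parameters `ω`, `ω₁` and `ω + 1`. -/
noncomputable def ordinalParams (δ : Ordinal.{u}) [h : Fact (omegaOne < δ)] : Fin 3 → Set.Iio δ :=
  ![⟨Ordinal.omega0, omega0_lt_omegaOne.trans h.out⟩, ⟨omegaOne, h.out⟩,
    ⟨Ordinal.omega0 + 1, omega0_add_one_lt_omegaOne.trans h.out⟩]

/-- The ordinal parameters as elements of `V_δ`. -/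
noncomputable def params (δ : Ordinal.{u}) [Fact (omegaOne < δ)] (i : Fin 3) : Level δ :=
  Level.ordinal (ordinalParams δ i)

/-- Elements of `V_δ` are determined by their elements in `V_δ`. -/
theorem Level.ext_iff' {δ : Ordinal.{u}} {a b : Level δ} :
    a = b ↔ ∀ c : Level δ, c.1 ∈ a.1 ↔ c.1 ∈ b.1 := by
  refine ⟨fun h _ => by rw [h], fun h => Subtype.ext (ZFSet.ext fun z => ?_)⟩
  constructor
  · intro hz
    exact (h ⟨z, (ZFSet.isTransitive_vonNeumann δ).subset_of_mem a.2 hz⟩).1 hz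
  · intro hz
    exact (h ⟨z, (ZFSet.isTransitive_vonNeumann δ).subset_of_mem b.2 hz⟩).2 hz

/-- `V_δ` is transitive, so quantifiers bounded by one of its elements mean the same inside and
outside. -/
theorem Level.exists_mem {δ : Ordinal.{u}} {a : Level δ} {P : ZFSet.{u} → Prop} :
    (∃ z ∈ a.1, P z) ↔ ∃ z : Level δ, z.1 ∈ a.1 ∧ P z.1 :=
  ⟨fun ⟨z, hz, h⟩ => ⟨⟨z, (ZFSet.isTransitive_vonNeumann δ).subset_of_mem a.2 hz⟩, hz, h⟩,
    fun ⟨z, hz, h⟩ => ⟨z.1, hz, h⟩⟩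

theorem Level.forall_mem {δ : Ordinal.{u}} {a : Level δ} {P : ZFSet.{u} → Prop} :
    (∀ z ∈ a.1, P z) ↔ ∀ z : Level δ, z.1 ∈ a.1 → P z.1 :=
  ⟨fun h z => h z.1,
    fun h z hz => h ⟨z, (ZFSet.isTransitive_vonNeumann δ).subset_of_mem a.2 hz⟩ hz⟩

/-- A predicate on assignments is definable over `V_δ` from the parameters. -/
class Definable (δ : Ordinal.{u}) [Fact (omegaOne < δ)] {Γ : Type v} [Context δ Γ]
    (P : Γ → Prop) : Prop where
  out : ∃ φ : setLanguage.Formula (Fin 3 ⊕ Index δ Γ),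
    ∀ γ, φ.Realize (Sum.elim (params δ) (value γ)) ↔ P γ

/-- A function on assignments is definable if its graph is. -/
class DefinableFun (δ : Ordinal.{u}) [Fact (omegaOne < δ)] {Γ : Type v} [Context δ Γ]
    {τ : Type w} [Coded δ τ] (f : Γ → τ) : Prop where
  out : Definable δ fun q : Γ × τ => f q.1 = q.2

/-- The range of the coding is definable. -/
class Quantifiable (δ : Ordinal.{u}) [Fact (omegaOne < δ)] (τ : Type v) [Coded δ τ] : Prop where
  out : Definable δ fun q : Unit × Level δ => q.2 ∈ Set.range (code : τ → Level δ)

/-! ### Closure under connectives and quantifiers -/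

section

variable {δ : Ordinal.{u}} [Fact (omegaOne < δ)] {Γ : Type v} [Context δ Γ]

theorem Definable.of_iff {P Q : Γ → Prop} (h : Definable δ P) (hPQ : ∀ γ, P γ ↔ Q γ) :
    Definable δ Q := by
  obtain ⟨φ, hφ⟩ := h
  exact ⟨φ, fun γ => (hφ γ).trans (hPQ γ)⟩

/-- Renaming of variables: covers adding, dropping and permuting them. -/
theorem Definable.pullback {Γ' : Type w} [Context δ Γ'] {P : Γ' → Prop} (h : Definable δ P)
    (m : Γ → Γ') (j : Index δ Γ' → Index δ Γ)
    (hm : ∀ γ i, (value (m γ) i : Level δ) = value γ (j i)) :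
    Definable δ fun γ => P (m γ) := by
  obtain ⟨φ, hφ⟩ := h
  refine ⟨φ.relabel (Sum.map id j), fun γ => ?_⟩
  rw [FirstOrder.Language.Formula.realize_relabel, ← hφ (m γ)]
  refine iff_of_eq (congrArg _ ?_)
  funext i
  rcases i with i | i
  · rfl
  · exact (hm γ i).symm

instance Definable.not {P : Γ → Prop} [h : Definable δ P] : Definable δ fun γ => ¬ P γ := by
  obtain ⟨φ, hφ⟩ := h
  exact ⟨φ.not, fun γ => by simp [FirstOrder.Language.Formula.realize_not, hφ]⟩

instance Definable.and {P Q : Γ → Prop} [h : Definable δ P] [h' : Definable δ Q] :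
    Definable δ fun γ => P γ ∧ Q γ := by
  obtain ⟨φ, hφ⟩ := h
  obtain ⟨ψ, hψ⟩ := h'
  exact ⟨φ ⊓ ψ, fun γ => by simp [FirstOrder.Language.Formula.realize_inf, hφ, hψ]⟩

instance Definable.or {P Q : Γ → Prop} [Definable δ P] [Definable δ Q] :
    Definable δ fun γ => P γ ∨ Q γ :=
  Definable.of_iff (P := fun γ => ¬ (¬ P γ ∧ ¬ Q γ)) inferInstance fun γ => by tauto

instance Definable.imp {P Q : Γ → Prop} [Definable δ P] [Definable δ Q] :
    Definable δ fun γ => P γ → Q γ :=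
  Definable.of_iff (P := fun γ => ¬ (P γ ∧ ¬ Q γ)) inferInstance fun γ => by tauto

instance Definable.iff {P Q : Γ → Prop} [Definable δ P] [Definable δ Q] :
    Definable δ fun γ => (P γ ↔ Q γ) :=
  Definable.of_iff (P := fun γ => (P γ → Q γ) ∧ (Q γ → P γ)) inferInstance fun γ => by tauto

/-- The quantifier over `τ` becomes a quantifier over `V_δ`, relativized to the formula that defines
the range of the coding. -/
instance Definable.ex {τ : Type w} [Coded δ τ] [hτ : Quantifiable δ τ] {P : Γ → τ → Prop}
    [h : Definable δ fun q : Γ × τ => P q.1 q.2] : Definable δ fun γ => ∃ t, P γ t := by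
  obtain ⟨φ, hφ⟩ := h
  obtain ⟨ψ, hψ⟩ := hτ.out
  let e : Fin 3 ⊕ (Index δ Γ ⊕ Unit) → (Fin 3 ⊕ Index δ Γ) ⊕ Unit := (Equiv.sumAssoc _ _ _).symm
  let e' : Fin 3 ⊕ (Empty ⊕ Unit) → (Fin 3 ⊕ Index δ Γ) ⊕ Unit :=
    Sum.elim (fun i => Sum.inl (Sum.inl i)) (Sum.elim Empty.elim Sum.inr)
  refine ⟨(ψ.relabel e' ⊓ φ.relabel e).iExs Unit, fun γ => ?_⟩
  rw [FirstOrder.Language.Formula.realize_iExs]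
  simp only [FirstOrder.Language.Formula.realize_inf,
    FirstOrder.Language.Formula.realize_relabel]
  have key' : ∀ a : Level δ, Sum.elim (Sum.elim (params δ) (value γ)) (fun _ : Unit => a) ∘ e' =
      Sum.elim (params δ) (value ((), a)) := by
    intro a
    funext i
    rcases i with i | i | i
    · rfl
    · exact i.elim
    · rfl
  have key : ∀ t : τ, Sum.elim (Sum.elim (params δ) (value γ)) (fun _ : Unit => code t) ∘ e =
      Sum.elim (params δ) (value (γ, t)) := by
    intro t
    funext i
    rcases i with i | i | i <;> rfl
  constructor
  · rintro ⟨i, h1, h2⟩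
    obtain ⟨a, rfl⟩ : ∃ a, i = fun _ => a := ⟨i (), rfl⟩
    rw [key', hψ] at h1
    obtain ⟨t, ht⟩ := h1
    dsimp only at ht
    rw [← ht, key, hφ] at h2
    exact ⟨t, h2⟩
  · rintro ⟨t, ht⟩
    refine ⟨fun _ => code t, ?_, ?_⟩
    · rw [key', hψ]; exact ⟨t, rfl⟩
    · rw [key, hφ]; exact ht

instance Definable.all {τ : Type w} [Coded δ τ] [hτ : Quantifiable δ τ] {P : Γ → τ → Prop}
    [h : Definable δ fun q : Γ × τ => P q.1 q.2] : Definable δ fun γ => ∀ t, P γ t :=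
  Definable.of_iff (P := fun γ => ¬ ∃ t, ¬ P γ t) inferInstance fun γ => by simp

/-- Membership of variables. -/
theorem Definable.mem_index (i j : Index δ Γ) :
    Definable δ fun γ : Γ => (value γ i : Level δ).1 ∈ (value γ j : Level δ).1 := by
  let R : setLanguage.Relations 2 := MemSymbol.mem
  refine ⟨R.formula₂ (FirstOrder.Language.Term.var (Sum.inr i))
    (FirstOrder.Language.Term.var (Sum.inr j)), fun γ => ?_⟩
  rw [FirstOrder.Language.Formula.realize_rel₂]
  rfl

theorem Definable.mem_param (i : Index δ Γ) (k : Fin 3) :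
    Definable δ fun γ : Γ => (value γ i : Level δ).1 ∈ (params δ k).1 := by
  let R : setLanguage.Relations 2 := MemSymbol.mem
  refine ⟨R.formula₂ (FirstOrder.Language.Term.var (Sum.inr i))
    (FirstOrder.Language.Term.var (Sum.inl k)), fun γ => ?_⟩
  rw [FirstOrder.Language.Formula.realize_rel₂]
  rfl

theorem Definable.eq_index (i j : Index δ Γ) :
    Definable δ fun γ : Γ => (value γ i : Level δ) = value γ j := by
  refine ⟨FirstOrder.Language.Term.equal (FirstOrder.Language.Term.var (Sum.inr i))
    (FirstOrder.Language.Term.var (Sum.inr j)), fun γ => ?_⟩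
  rw [FirstOrder.Language.Formula.realize_equal]
  rfl

theorem Definable.eq_param (i : Index δ Γ) (k : Fin 3) :
    Definable δ fun γ : Γ => params δ k = value γ i := by
  refine ⟨FirstOrder.Language.Term.equal (FirstOrder.Language.Term.var (Sum.inl k))
    (FirstOrder.Language.Term.var (Sum.inr i)), fun γ => ?_⟩
  rw [FirstOrder.Language.Formula.realize_equal]
  rfl

end

/-! ### Variables, substitution of definable functions, ordered pairs -/

section

variable {δ : Ordinal.{u}} [Fact (omegaOne < δ)] {Γ : Type v} [Context δ Γ]
  {τ : Type w} [Coded δ τ] {σ : Type w'} [Coded δ σ]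

instance Quantifiable.level : Quantifiable δ (Level δ) :=
  ⟨(Definable.eq_index (δ := δ) (Γ := Unit × Level δ) (Sum.inr ()) (Sum.inr ())).of_iff fun γ => by
    simp [code]⟩

theorem DefinableFun.of_index {f : Γ → τ} (i : Index δ Γ) (h : ∀ γ, code (f γ) = value γ i) :
    DefinableFun δ f :=
  ⟨(Definable.eq_index (δ := δ) (Γ := Γ × τ) (Sum.inl i) (Sum.inr ())).of_iff fun γ =>
    ⟨fun h' => code_injective ((h γ.1).trans h'), fun h' => (h γ.1).symm.trans (congrArg code h')⟩⟩

/-- This instance and the next ones are de Bruijn variables. With them, instance search can find the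
formula for a statement written with nested quantifiers. -/
instance DefinableFun.var0 : DefinableFun δ fun q : Γ × τ => q.2 :=
  .of_index (Sum.inr ()) fun _ => rfl

section

variable {τ₁ τ₂ τ₃ τ₄ τ₅ τ₆ : Type*} [Coded δ τ₁] [Coded δ τ₂] [Coded δ τ₃] [Coded δ τ₄]
  [Coded δ τ₅] [Coded δ τ₆]

instance DefinableFun.var1 : DefinableFun δ fun q : (Γ × τ) × τ₁ => q.1.2 :=
  .of_index (Sum.inl (Sum.inr ())) fun _ => rfl

instance DefinableFun.var2 : DefinableFun δ fun q : ((Γ × τ) × τ₁) × τ₂ => q.1.1.2 :=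
  .of_index (Sum.inl (Sum.inl (Sum.inr ()))) fun _ => rfl

instance DefinableFun.var3 : DefinableFun δ fun q : (((Γ × τ) × τ₁) × τ₂) × τ₃ => q.1.1.1.2 :=
  .of_index (Sum.inl (Sum.inl (Sum.inl (Sum.inr ())))) fun _ => rfl

instance DefinableFun.var4 :
    DefinableFun δ fun q : ((((Γ × τ) × τ₁) × τ₂) × τ₃) × τ₄ => q.1.1.1.1.2 :=
  .of_index (Sum.inl (Sum.inl (Sum.inl (Sum.inl (Sum.inr ()))))) fun _ => rfl

instance DefinableFun.var5 :
    DefinableFun δ fun q : (((((Γ × τ) × τ₁) × τ₂) × τ₃) × τ₄) × τ₅ => q.1.1.1.1.1.2 :=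
  .of_index (Sum.inl (Sum.inl (Sum.inl (Sum.inl (Sum.inl (Sum.inr ())))))) fun _ => rfl

instance DefinableFun.var6 :
    DefinableFun δ fun q : ((((((Γ × τ) × τ₁) × τ₂) × τ₃) × τ₄) × τ₅) × τ₆ =>
      q.1.1.1.1.1.1.2 :=
  .of_index (Sum.inl (Sum.inl (Sum.inl (Sum.inl (Sum.inl (Sum.inl (Sum.inr ()))))))) fun _ => rfl

end

theorem DefinableFun.weaken {f : Γ → τ} (hf : DefinableFun δ f) :
    DefinableFun δ fun q : Γ × σ => f q.1 :=
  ⟨hf.out.pullback (fun q : (Γ × σ) × τ => (q.1.1, q.2))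
    (Sum.elim (fun i => Sum.inl (Sum.inl i)) fun _ => Sum.inr ()) fun γ i => by rcases i with i | i <;> rfl⟩

/-- A function is known only through its graph, so its value is introduced by an existential
quantifier. -/
theorem Definable.subst [Quantifiable δ τ] {P : Γ × τ → Prop} (h : Definable δ P) {f : Γ → τ}
    (hf : DefinableFun δ f) : Definable δ fun γ => P (γ, f γ) :=
  have := hf.out
  Definable.of_iff (P := fun γ => ∃ t, f γ = t ∧ P (γ, t)) inferInstance fun γ => by simp

theorem Definable.comp [Quantifiable δ τ] {R : τ → Prop}
    (h : Definable δ fun q : Unit × τ => R q.2) (f : Γ → τ) [hf : DefinableFun δ f] :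
    Definable δ fun γ => R (f γ) :=
  (h.pullback (fun q : Γ × τ => ((), q.2)) (Sum.elim Empty.elim Sum.inr) fun γ i => by
    rcases i with i | i
    · exact i.elim
    · rfl).subst hf

theorem Definable.comp₂ [Quantifiable δ τ] [Quantifiable δ σ] {R : τ → σ → Prop}
    (h : Definable δ fun q : (Unit × τ) × σ => R q.1.2 q.2) (f : Γ → τ) (g : Γ → σ)
    [hf : DefinableFun δ f] [hg : DefinableFun δ g] : Definable δ fun γ => R (f γ) (g γ) :=
  ((h.pullback (fun q : (Γ × τ) × σ => (((), q.1.2), q.2))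
    (Sum.elim (Sum.elim Empty.elim fun _ => Sum.inl (Sum.inr ())) Sum.inr) fun γ i => by
    rcases i with (i | i) | i
    · exact i.elim
    · rfl
    · rfl).subst hg.weaken).subst hf

theorem Definable.comp₃ [Quantifiable δ τ] [Quantifiable δ σ] {ρ : Type*} [Coded δ ρ]
    [Quantifiable δ ρ] {R : τ → σ → ρ → Prop}
    (h : Definable δ fun q : ((Unit × τ) × σ) × ρ => R q.1.1.2 q.1.2 q.2)
    (f : Γ → τ) (g : Γ → σ) (k : Γ → ρ)
    [hf : DefinableFun δ f] [hg : DefinableFun δ g] [hk : DefinableFun δ k] :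
    Definable δ fun γ => R (f γ) (g γ) (k γ) :=
  (((h.pullback (fun q : ((Γ × τ) × σ) × ρ => ((((), q.1.1.2), q.1.2), q.2))
    (Sum.elim (Sum.elim (Sum.elim Empty.elim fun _ => Sum.inl (Sum.inl (Sum.inr ())))
      fun _ => Sum.inl (Sum.inr ())) Sum.inr) fun γ i => by
    rcases i with ((i | i) | i) | i
    · exact i.elim
    · rfl
    · rfl
    · rfl).subst hk.weaken.weaken).subst hg.weaken).subst hf

instance DefinableFun.code_comp [Quantifiable δ τ] {f : Γ → τ} [DefinableFun δ f] :
    DefinableFun δ fun γ => (code (f γ) : Level δ) :=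
  have : DefinableFun δ fun q : Γ × Level δ => f q.1 := .weaken inferInstance
  ⟨(Definable.eq_index (δ := δ) (Γ := (Unit × τ) × Level δ) (Sum.inl (Sum.inr ())) (Sum.inr ())).comp₂
    (R := fun a b => Coded.code a = b) (fun q : Γ × Level δ => f q.1) (fun q => q.2)⟩

instance Definable.level_mem {f g : Γ → Level δ} [DefinableFun δ f] [DefinableFun δ g] :
    Definable δ fun γ => (f γ).1 ∈ (g γ).1 :=
  (Definable.mem_index (δ := δ) (Γ := (Unit × Level δ) × Level δ) (Sum.inl (Sum.inr ())) (Sum.inr ())).comp₂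
    (R := fun a b => a.1 ∈ b.1) f g

instance Definable.eq [Quantifiable δ τ] {f g : Γ → τ} [DefinableFun δ f] [DefinableFun δ g] :
    Definable δ fun γ => f γ = g γ :=
  ((Definable.eq_index (δ := δ) (Γ := (Unit × τ) × τ) (Sum.inl (Sum.inr ())) (Sum.inr ())).of_iff
    fun _ => code_injective.eq_iff).comp₂ (R := fun a b => a = b) f g

/-- All quantifiers range over members of the candidate pair, which lie in `V_δ` by transitivity. So
no closure of `V_δ` under pairing is needed, which fails at successor `δ`. -/
instance Definable.level_eq_pair {f g k : Γ → Level δ} [DefinableFun δ f] [DefinableFun δ g]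
    [DefinableFun δ k] : Definable δ fun γ => (f γ).1 = ZFSet.pair (g γ).1 (k γ).1 := by
  have h2 : Definable δ fun q : ((Unit × Level δ) × Level δ) × Level δ =>
      q.1.1.2.1 = ({q.1.2.1, q.2.1} : ZFSet) := by
    refine Definable.of_iff (P := fun q => (q.1.2.1 ∈ q.1.1.2.1 ∧ q.2.1 ∈ q.1.1.2.1) ∧
      ∀ w : Level δ, w.1 ∈ q.1.1.2.1 → w = q.1.2 ∨ w = q.2) inferInstance ?_
    rintro ⟨⟨⟨-, z⟩, a⟩, b⟩
    simp only [Subtype.ext_iff]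
    rw [← Level.forall_mem (P := fun w => w = a.1 ∨ w = b.1)]
    constructor
    · rintro ⟨⟨h1, h2⟩, h3⟩
      ext w
      rw [ZFSet.mem_pair]
      refine ⟨h3 w, ?_⟩
      rintro (rfl | rfl) <;> assumption
    · intro h
      rw [h]
      simp
  have h2' : ∀ {Γ' : Type (u + 1)} [Context δ Γ'] (f g k : Γ' → Level δ) [DefinableFun δ f]
      [DefinableFun δ g] [DefinableFun δ k],
      Definable δ fun γ => (f γ).1 = ({(g γ).1, (k γ).1} : ZFSet) :=
    fun f g k => h2.comp₃ (R := fun a b c : Level δ => a.1 = ({b.1, c.1} : ZFSet)) f g k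
  have h3 : Definable δ fun q : ((Unit × Level δ) × Level δ) × Level δ =>
      q.1.1.2.1 = ZFSet.pair q.1.2.1 q.2.1 := by
    have i1 := h2' (fun q : (((Unit × Level δ) × Level δ) × Level δ) × Level δ => q.2)
      (fun q => q.1.1.2) (fun q => q.1.1.2)
    have i2 := h2' (fun q : (((Unit × Level δ) × Level δ) × Level δ) × Level δ => q.2)
      (fun q => q.1.1.2) (fun q => q.1.2)
    refine Definable.of_iff (P := fun q => ((∃ z : Level δ, z.1 ∈ q.1.1.2.1 ∧
        z.1 = ({q.1.2.1, q.1.2.1} : ZFSet)) ∧ ∃ z : Level δ, z.1 ∈ q.1.1.2.1 ∧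
        z.1 = ({q.1.2.1, q.2.1} : ZFSet)) ∧
      ∀ w : Level δ, w.1 ∈ q.1.1.2.1 → w.1 = ({q.1.2.1, q.1.2.1} : ZFSet) ∨
        w.1 = ({q.1.2.1, q.2.1} : ZFSet)) inferInstance ?_
    rintro ⟨⟨⟨-, z⟩, a⟩, b⟩
    simp only
    rw [← Level.exists_mem (P := fun w => w = ({a.1, a.1} : ZFSet)),
      ← Level.exists_mem (P := fun w => w = ({a.1, b.1} : ZFSet)),
      ← Level.forall_mem (P := fun w => w = ({a.1, a.1} : ZFSet) ∨ w = ({a.1, b.1} : ZFSet))]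
    simp only [exists_eq_right, ZFSet.pair_eq_singleton]
    constructor
    · rintro ⟨⟨h1, h2⟩, h3⟩
      ext w
      rw [ZFSet.pair, ZFSet.mem_pair]
      refine ⟨h3 w, ?_⟩
      rintro (rfl | rfl) <;> assumption
    · intro h
      rw [h]
      simp [ZFSet.pair]
  exact h3.comp₃ (R := fun a b c : Level δ => a.1 = ZFSet.pair b.1 c.1) f g k

end

/-! ### Codings of natural numbers, ordinals, pairs, sets and functions -/

/-- All codes have rank below `ω₁`. -/
class Inner (δ : Ordinal.{u}) (τ : Type v) [Coded δ τ] : Prop where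
  rank_lt : ∀ a : τ, (code a : Level δ).1.rank < omegaOne

/-- The ranks of codes are bounded below `ω₁`. -/
class InnerBounded (δ : Ordinal.{u}) (τ : Type v) [Coded δ τ] : Prop where
  exists_bound : ∃ β < omegaOne.{u}, ∀ a : τ, (code a : Level δ).1.rank < β

instance (δ : Ordinal.{u}) (τ : Type v) [Coded δ τ] [h : InnerBounded δ τ] : Inner δ τ :=
  ⟨fun a => let ⟨_, h1, h2⟩ := h.exists_bound; (h2 a).trans h1⟩

section

variable {δ : Ordinal.{u}} [hδ : Fact (omegaOne < δ)]

theorem rank_lt_of_fact {x : ZFSet.{u}} (h : x.rank ≤ omegaOne) : x ∈ ZFSet.vonNeumann δ :=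
  ZFSet.mem_vonNeumann.2 (h.trans_lt hδ.out)

noncomputable instance : Coded δ ℕ where
  code n := ⟨natCode n, rank_lt_of_fact ((rank_natCode_lt n).trans omega0_lt_omegaOne).le⟩
  code_injective a b h := by
    have := Ordinal.toZFSet_injective (congrArg Subtype.val h)
    exact_mod_cast this

instance : InnerBounded δ ℕ := ⟨⟨_, omega0_lt_omegaOne, rank_natCode_lt⟩⟩

instance : Quantifiable δ ℕ :=
  ⟨(Definable.mem_param (Γ := Unit × Level δ) (Sum.inr ()) 0).of_iff fun γ => by
    rw [show params δ 0 = Level.ordinal ⟨Ordinal.omega0, omega0_lt_omegaOne.trans hδ.out⟩ from rfl,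
      Level.ordinal, Ordinal.mem_toZFSet_iff]
    constructor
    · rintro ⟨a, ha, h⟩
      obtain ⟨n, rfl⟩ := Ordinal.lt_omega0.1 ha
      exact ⟨n, Subtype.ext h⟩
    · rintro ⟨n, h⟩
      exact ⟨n, Ordinal.natCast_lt_omega0 n, congrArg Subtype.val h⟩⟩

noncomputable instance : Coded δ (Set.Iio omegaOne.{u}) where
  code α := Level.ordinal ⟨α.1, lt_trans (Set.mem_Iio.1 α.2) hδ.out⟩
  code_injective _ _ h := Subtype.ext (Ordinal.toZFSet_injective (congrArg Subtype.val h))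

instance : Inner δ (Set.Iio omegaOne.{u}) :=
  ⟨fun α => (Ordinal.rank_toZFSet α.1).trans_lt α.2⟩

instance : Quantifiable δ (Set.Iio omegaOne.{u}) :=
  ⟨(Definable.mem_param (Γ := Unit × Level δ) (Sum.inr ()) 1).of_iff fun γ => by
    rw [show params δ 1 = Level.ordinal ⟨omegaOne, hδ.out⟩ from rfl,
      Level.ordinal, Ordinal.mem_toZFSet_iff]
    constructor
    · rintro ⟨a, ha, h⟩
      exact ⟨⟨a, ha⟩, Subtype.ext h⟩
    · rintro ⟨a, h⟩
      exact ⟨a.1, a.2, congrArg Subtype.val h⟩⟩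

section

variable (τ : Type v) [Coded δ τ] (σ : Type w) [Coded δ σ]

noncomputable instance [Inner δ τ] [Inner δ σ] : Coded δ (τ × σ) where
  code p := ⟨ZFSet.pair (code p.1 : Level δ).1 (code p.2 : Level δ).1, rank_lt_of_fact
    (rank_pair_lt omegaOne_isSuccLimit (Inner.rank_lt _) (Inner.rank_lt _)).le⟩
  code_injective p q h := by
    obtain ⟨h1, h2⟩ := ZFSet.pair_injective (congrArg Subtype.val h)
    exact Prod.ext (code_injective (Subtype.ext h1)) (code_injective (Subtype.ext h2))

instance [Inner δ τ] [Inner δ σ] : Inner δ (τ × σ) :=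
  ⟨fun _ => rank_pair_lt omegaOne_isSuccLimit (Inner.rank_lt _) (Inner.rank_lt _)⟩

instance [hτ : InnerBounded δ τ] [hσ : InnerBounded δ σ] : InnerBounded δ (τ × σ) := by
  obtain ⟨a, ha, ha'⟩ := hτ.exists_bound
  obtain ⟨b, hb, hb'⟩ := hσ.exists_bound
  refine ⟨⟨Order.succ (Order.succ (max a b)), omegaOne_isSuccLimit.succ_lt
    (omegaOne_isSuccLimit.succ_lt (max_lt ha hb)), fun p => ?_⟩⟩
  have h1 := (ha' p.1).trans_le (le_max_left a b)
  have h2 := (hb' p.2).trans_le (le_max_right a b)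
  change (ZFSet.pair _ _).rank < _
  rw [ZFSet.pair, ZFSet.rank_pair, ZFSet.rank_singleton, ZFSet.rank_pair, Order.lt_succ_iff]
  refine max_le (Order.succ_le_succ ?_) (Order.succ_le_succ (max_le ?_ ?_)) <;>
    exact Order.succ_le_of_lt (by assumption)

instance [Inner δ τ] [Inner δ σ] [Quantifiable δ τ] [Quantifiable δ σ] :
    Quantifiable δ (τ × σ) :=
  ⟨Definable.of_iff (P := fun q => ∃ (a : τ) (b : σ),
      q.2.1 = ZFSet.pair (code a : Level δ).1 (code b : Level δ).1) inferInstance fun q => by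
    constructor
    · rintro ⟨a, b, h⟩
      exact ⟨(a, b), Subtype.ext h.symm⟩
    · rintro ⟨⟨a, b⟩, h⟩
      exact ⟨a, b, (congrArg Subtype.val h).symm⟩⟩

/-- Separation from `V_{ω₁}` gives a set whatever the universe of `τ`, and bounds its rank by `ω₁`.
-/
noncomputable instance [Inner δ τ] : Coded δ (Set τ) where
  code s := ⟨ZFSet.sep (fun z => ∃ a ∈ s, (code a : Level δ).1 = z) (ZFSet.vonNeumann omegaOne),
    rank_lt_of_fact (ZFSet.subset_vonNeumann.1 (ZFSet.sep_subset ..))⟩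
  code_injective s t h := by
    have h' := congrArg Subtype.val h
    ext a
    have := congrArg ((code a : Level δ).1 ∈ ·) h'
    simpa [ZFSet.mem_sep, ZFSet.mem_vonNeumann, Inner.rank_lt, ← Subtype.ext_iff,
      code_injective.eq_iff] using this

end

variable {τ : Type v} [Coded δ τ] {σ : Type w} [Coded δ σ]

theorem mem_code_set [Inner δ τ] {s : Set τ} {z : ZFSet.{u}} :
    z ∈ (code s : Level δ).1 ↔ ∃ a ∈ s, (code a : Level δ).1 = z := by
  change z ∈ ZFSet.sep (fun z => ∃ a ∈ s, (code a : Level δ).1 = z) (ZFSet.vonNeumann omegaOne) ↔ _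
  rw [ZFSet.mem_sep, ZFSet.mem_vonNeumann, and_iff_right_iff_imp]
  rintro ⟨a, -, rfl⟩
  exact Inner.rank_lt a

theorem code_mem_code_set [Inner δ τ] {s : Set τ} {a : τ} :
    (code a : Level δ).1 ∈ (code s : Level δ).1 ↔ a ∈ s := by
  rw [mem_code_set]
  simp [code_injective.eq_iff]

/-- A uniform bound survives the passage to sets. With `Inner` alone a set may have rank `ω₁`, and
sets of such sets need not belong to `V_δ`. -/
instance [hτ : InnerBounded δ τ] : InnerBounded δ (Set τ) := by
  obtain ⟨a, ha, ha'⟩ := hτ.exists_bound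
  refine ⟨⟨Order.succ a, omegaOne_isSuccLimit.succ_lt ha, fun s => ?_⟩⟩
  rw [Order.lt_succ_iff, ZFSet.rank_le_iff]
  intro z hz
  obtain ⟨b, -, rfl⟩ := mem_code_set.1 hz
  exact ha' b

/-- An element of `V_δ` whose members are all codes is itself the code of a set. Thus full
second-order quantification over `τ` is first-order over `V_δ`. -/
instance [Inner δ τ] [hτ : Quantifiable δ τ] : Quantifiable δ (Set τ) :=
  ⟨Definable.of_iff (P := fun q => ∀ z : Level δ, z.1 ∈ q.2.1 → ∃ a : τ, code a = z)
    inferInstance fun q => by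
    rw [Set.mem_range]
    constructor
    · intro h
      refine ⟨{a | (code a : Level δ).1 ∈ q.2.1}, Level.ext_iff'.2 fun c => ?_⟩
      rw [mem_code_set]
      constructor
      · rintro ⟨a, ha, h'⟩
        rwa [← h']
      · intro hc
        obtain ⟨a, rfl⟩ := h c hc
        exact ⟨a, hc, rfl⟩
    · rintro ⟨s, h⟩ z hz
      rw [← h, mem_code_set] at hz
      obtain ⟨a, -, h⟩ := hz
      exact ⟨a, Subtype.ext h⟩⟩

variable {Γ : Type w'} [Context δ Γ]

instance DefinableFun.prodMk [Inner δ τ] [Inner δ σ] [Quantifiable δ τ] [Quantifiable δ σ]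
    {f : Γ → τ} {g : Γ → σ} [hf : DefinableFun δ f] [hg : DefinableFun δ g] :
    DefinableFun δ fun γ => (f γ, g γ) := by
  have h1 : DefinableFun δ fun q : Γ × (τ × σ) => f q.1 := hf.weaken
  have h2 : DefinableFun δ fun q : Γ × (τ × σ) => g q.1 := hg.weaken
  exact ⟨Definable.of_iff (P := fun q => (code q.2 : Level δ).1 =
    ZFSet.pair (code (f q.1) : Level δ).1 (code (g q.1) : Level δ).1) inferInstance fun q =>
      ⟨fun h => (code_injective (δ := δ) (a₁ := q.2) (a₂ := (f q.1, g q.1)) (Subtype.ext h)).symm,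
        fun h => by rw [← h]; rfl⟩⟩

instance Definable.mem_set [Inner δ τ] [Quantifiable δ τ] {f : Γ → τ} {s : Γ → Set τ}
    [hf : DefinableFun δ f] [hs : DefinableFun δ s] : Definable δ fun γ => f γ ∈ s γ :=
  Definable.of_iff (P := fun γ => (code (f γ) : Level δ).1 ∈ (code (s γ) : Level δ).1)
    inferInstance fun _ => code_mem_code_set

/-! ### Functions -/

/-- The graph of a function. -/
def funGraph {τ : Type v} {σ : Type w} (f : τ → σ) : Set (τ × σ) := {p | f p.1 = p.2}

theorem mem_funGraph {τ : Type v} {σ : Type w} {f : τ → σ} {a : τ} {b : σ} :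
    (a, b) ∈ funGraph f ↔ f a = b := Iff.rfl

theorem funGraph_injective {τ : Type v} {σ : Type w} :
    Function.Injective (funGraph : (τ → σ) → Set (τ × σ)) := fun f g h => funext fun a => by
  have : (a, f a) ∈ funGraph g := h ▸ mem_funGraph.2 rfl
  exact (mem_funGraph.1 this).symm

noncomputable instance [Inner δ τ] [Inner δ σ] : Coded δ (τ → σ) where
  code f := code (funGraph f)
  code_injective := code_injective.comp funGraph_injective

theorem code_fun_eq [Inner δ τ] [Inner δ σ] (f : τ → σ) :
    (code f : Level δ) = code (funGraph f) := rfl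

instance [Inner δ τ] [Inner δ σ] [Quantifiable δ τ] [Quantifiable δ σ] :
    Quantifiable δ (τ → σ) :=
  ⟨Definable.of_iff (P := fun q => ∃ G : Set (τ × σ), code G = q.2 ∧
      ∀ a : τ, ∃ b : σ, (a, b) ∈ G ∧ ∀ c : σ, (a, c) ∈ G → b = c) inferInstance fun q => by
    constructor
    · rintro ⟨G, hG, h⟩
      choose f hf hf' using h
      refine ⟨f, hG ▸ congrArg (code (δ := δ) (τ := Set (τ × σ))) (Set.ext fun p => ?_)⟩
      exact ⟨fun hp => by have := hf p.1; rwa [show f p.1 = p.2 from hp] at this, fun hp => hf' _ _ hp⟩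
    · rintro ⟨f, h⟩
      exact ⟨funGraph f, h, fun a => ⟨f a, rfl, fun c hc => hc⟩⟩⟩

instance DefinableFun.funGraph_comp [Inner δ τ] [Inner δ σ] [Quantifiable δ τ] [Quantifiable δ σ]
    {f : Γ → τ → σ} [hf : DefinableFun δ f] :
    DefinableFun δ fun γ => LongGame.funGraph (f γ) := by
  have h1 : DefinableFun δ fun q : Γ × Set (τ × σ) => f q.1 := hf.weaken
  exact ⟨Definable.of_iff (P := fun q => (code (f q.1) : Level δ) = code q.2) inferInstance
    fun q => by rw [code_fun_eq, (code_injective (δ := δ)).eq_iff]⟩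

/-! ### The order of natural numbers and countable ordinals -/

instance Definable.nat_lt {f g : Γ → ℕ} [DefinableFun δ f] [DefinableFun δ g] :
    Definable δ fun γ => f γ < g γ :=
  Definable.of_iff (P := fun γ => (code (f γ) : Level δ).1 ∈ (code (g γ) : Level δ).1)
    inferInstance fun _ => Ordinal.toZFSet_mem_toZFSet_iff.trans Nat.cast_lt

instance DefinableFun.nat_zero : DefinableFun δ fun _ : Γ => 0 :=
  ⟨Definable.of_iff (P := fun q => ∀ m : ℕ, ¬ m < q.2) inferInstance fun q =>
    ⟨fun h => (Nat.eq_zero_of_not_pos (h 0)).symm, fun h m => by rw [← h]; exact Nat.not_lt_zero m⟩⟩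

instance DefinableFun.nat_add_one {f : Γ → ℕ} [hf : DefinableFun δ f] :
    DefinableFun δ fun γ => f γ + 1 := by
  have h1 : DefinableFun δ fun q : Γ × ℕ => f q.1 := hf.weaken
  have h2 : DefinableFun δ fun q : (Γ × ℕ) × ℕ => f q.1.1 := h1.weaken
  exact ⟨Definable.of_iff (P := fun q => f q.1 < q.2 ∧ ∀ m : ℕ, m < q.2 → ¬ f q.1 < m)
    inferInstance fun q => ⟨fun ⟨ha, hb⟩ => by
      by_contra hne
      exact hb (f q.1 + 1) (by omega) (by omega), fun h => ⟨by omega, fun m => by omega⟩⟩⟩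

instance Definable.ordinal_lt {f g : Γ → Set.Iio omegaOne.{u}} [DefinableFun δ f]
    [DefinableFun δ g] : Definable δ fun γ => f γ < g γ :=
  Definable.of_iff (P := fun γ => (code (f γ) : Level δ).1 ∈ (code (g γ) : Level δ).1)
    inferInstance fun _ => Ordinal.toZFSet_mem_toZFSet_iff

instance Definable.ordinal_covBy {f g : Γ → Set.Iio omegaOne.{u}} [hf : DefinableFun δ f]
    [hg : DefinableFun δ g] : Definable δ fun γ => f γ ⋖ g γ := by
  have h1 : DefinableFun δ fun q : Γ × Set.Iio omegaOne.{u} => f q.1 := hf.weaken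
  have h2 : DefinableFun δ fun q : Γ × Set.Iio omegaOne.{u} => g q.1 := hg.weaken
  exact Definable.of_iff (P := fun γ => f γ < g γ ∧ ∀ c : Set.Iio omegaOne.{u},
    f γ < c → ¬ c < g γ) inferInstance fun γ => Iff.rfl

end

/-! ### Definability of the pairing function -/

/-- Closure under the successor steps of the enumeration `Nat.unpair` of pairs. -/
def UnpairClosed (C : Set (ℕ × (ℕ × ℕ))) : Prop :=
  (0, (0, 0)) ∈ C ∧ ∀ n a b : ℕ, (n, (a, b)) ∈ C →
    ((a + 1 < b → (n + 1, (a + 1, b)) ∈ C) ∧ (a + 1 = b → (n + 1, (b, 0)) ∈ C)) ∧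
    ((b < a → (n + 1, (a, b + 1)) ∈ C) ∧ (a = b → (n + 1, (0, a + 1)) ∈ C))

/-- The four steps walk through the pairs in the order of `Nat.unpair`, around the square shells.
The least closed set is therefore the graph of the pairing, described with successor and order only.
-/
theorem pair_eq_iff_forall_closed (a b n : ℕ) :
    Nat.pair a b = n ↔ ∀ C, UnpairClosed C → (n, (a, b)) ∈ C := by
  constructor
  · rintro rfl C ⟨h0, hs⟩
    have key : ∀ n, (n, Nat.unpair n) ∈ C := by
      intro n
      induction n with
      | zero => exact h0
      | succ n ih =>
        obtain ⟨a, b, hab⟩ : ∃ a b, Nat.unpair n = (a, b) := ⟨_, _, rfl⟩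
        have hn : Nat.pair a b = n := by rw [← Nat.pair_unpair n, hab]
        rw [hab] at ih
        obtain ⟨⟨h1, h2⟩, h3, h4⟩ := hs n a b ih
        have step : ∀ c d, Nat.pair c d = n + 1 → (n + 1, (c, d)) ∈ C →
            (n + 1, Nat.unpair (n + 1)) ∈ C := by
          intro c d h h'
          rwa [← h, Nat.unpair_pair, h]
        rcases lt_trichotomy a b with h | h | h
        · have hn' : b * b + a = n := by rw [← hn, Nat.pair, if_pos h]
          rcases (Nat.succ_le_of_lt h).lt_or_eq with h' | h'
          · refine step _ _ ?_ (h1 h')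
            rw [Nat.pair, if_pos h']
            omega
          · refine step _ _ ?_ (h2 h')
            rw [Nat.pair, if_neg (Nat.not_lt_zero _)]
            have : a + 1 = b := h'
            omega
        · have hn' : a * a + a + b = n := by rw [← hn, Nat.pair, if_neg (by omega)]
          refine step _ _ ?_ (h4 h)
          rw [Nat.pair, if_pos (Nat.succ_pos _)]
          subst h
          linarith [add_mul_self_eq a 1]
        · have hn' : a * a + a + b = n := by rw [← hn, Nat.pair, if_neg (by omega)]
          refine step _ _ ?_ (h3 h)
          rw [Nat.pair, if_neg (by omega)]
          omega
    simpa using key (Nat.pair a b)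
  · intro h
    refine h {p | Nat.pair p.2.1 p.2.2 = p.1} ⟨by simp [Nat.pair], ?_⟩
    intro n a b hn
    change Nat.pair a b = n at hn
    simp only [Set.mem_ofPred_eq]
    refine ⟨⟨fun h => ?_, fun h => ?_⟩, fun h => ?_, fun h => ?_⟩
    · rw [Nat.pair, if_pos (by omega)] at hn ⊢
      omega
    · rw [Nat.pair, if_pos (by omega)] at hn
      rw [Nat.pair, if_neg (Nat.not_lt_zero _)]
      omega
    · rw [Nat.pair, if_neg (by omega)] at hn ⊢
      omega
    · rw [Nat.pair, if_neg (by omega)] at hn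
      rw [Nat.pair, if_pos (Nat.succ_pos _)]
      subst h
      linarith [add_mul_self_eq a 1]

/-! ### Turing reducibility through closed families of relations -/

/-- The graph of a partial function. -/
def partialGraph (f : ℕ → Part ℕ) : Set (ℕ × ℕ) := {p | p.2 ∈ f p.1}

theorem mem_partialGraph {f : ℕ → Part ℕ} {n m : ℕ} : (n, m) ∈ partialGraph f ↔ m ∈ f n := Iff.rfl

theorem partialGraph_injective : Function.Injective partialGraph := fun f g h =>
  funext fun n => Part.ext fun m => by
    rw [← mem_partialGraph, h, mem_partialGraph]

theorem partialGraph_coe (f : ℕ → ℕ) : partialGraph (fun n => Part.some (f n)) = funGraph f := by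
  ext ⟨n, m⟩
  rw [mem_partialGraph, Part.mem_some_iff, mem_funGraph, eq_comm]

/-- The family contains zero, successor and the projections of pairs. -/
def ContainsBasic (C : Set (Set (ℕ × ℕ))) : Prop :=
  ∀ k : Set (ℕ × ℕ),
    ((∀ n m : ℕ, (n, m) ∈ k ↔ m = 0) → k ∈ C) ∧ ((∀ n m : ℕ, (n, m) ∈ k ↔ m = n + 1) → k ∈ C) ∧
    ((∀ a b m : ℕ, (Nat.pair a b, m) ∈ k ↔ m = a) → k ∈ C) ∧
    ((∀ a b m : ℕ, (Nat.pair a b, m) ∈ k ↔ m = b) → k ∈ C)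

/-- The result `k` is described by its members and not constructed, which keeps the condition
first-order in the relations; likewise below. -/
def ClosedPair (C : Set (Set (ℕ × ℕ))) : Prop :=
  ∀ f h k : Set (ℕ × ℕ), f ∈ C → h ∈ C →
    (∀ n m : ℕ, (n, m) ∈ k ↔ ∃ a b : ℕ, ((n, a) ∈ f ∧ (n, b) ∈ h) ∧ Nat.pair a b = m) → k ∈ C

def ClosedComp (C : Set (Set (ℕ × ℕ))) : Prop :=
  ∀ f h k : Set (ℕ × ℕ), f ∈ C → h ∈ C →
    (∀ n m : ℕ, (n, m) ∈ k ↔ ∃ a : ℕ, (n, a) ∈ h ∧ (a, m) ∈ f) → k ∈ C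

/-- Every number is a pair, so the two equations determine `k`, by induction on the second
component. -/
def ClosedPrec (C : Set (Set (ℕ × ℕ))) : Prop :=
  ∀ f h k : Set (ℕ × ℕ), f ∈ C → h ∈ C →
    (∀ a m : ℕ, (Nat.pair a 0, m) ∈ k ↔ (a, m) ∈ f) →
    (∀ a y m : ℕ, (Nat.pair a (y + 1), m) ∈ k ↔
      ∃ i : ℕ, (Nat.pair a y, i) ∈ k ∧ (Nat.pair a (Nat.pair y i), m) ∈ h) → k ∈ C

def ClosedFind (C : Set (Set (ℕ × ℕ))) : Prop :=
  ∀ f k : Set (ℕ × ℕ), f ∈ C →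
    (∀ a m : ℕ, (a, m) ∈ k ↔ (Nat.pair a m, 0) ∈ f ∧
      ∀ j : ℕ, j < m → ∃ i : ℕ, (Nat.pair a j, i) ∈ f ∧ ¬ i = 0) → k ∈ C

/-- The closure conditions on a family of relations that characterize recursiveness. -/
def RecursivelyClosed (C : Set (Set (ℕ × ℕ))) : Prop :=
  (ContainsBasic C ∧ ClosedPair C) ∧ ClosedComp C ∧ ClosedPrec C ∧ ClosedFind C

/-- Primitive recursion for partial functions. -/
def partialPrec (f h : ℕ → Part ℕ) (p : ℕ) : Part ℕ :=
  Nat.rec (f (Nat.unpair p).1)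
    (fun y IH => IH.bind fun i => h (Nat.pair (Nat.unpair p).1 (Nat.pair y i))) (Nat.unpair p).2

theorem partialPrec_zero (f h : ℕ → Part ℕ) (a : ℕ) : partialPrec f h (Nat.pair a 0) = f a := by
  rw [partialPrec, Nat.unpair_pair]
  rfl

theorem partialPrec_succ (f h : ℕ → Part ℕ) (a y : ℕ) :
    partialPrec f h (Nat.pair a (y + 1)) =
      (partialPrec f h (Nat.pair a y)).bind fun i => h (Nat.pair a (Nat.pair y i)) := by
  rw [partialPrec, partialPrec, Nat.unpair_pair, Nat.unpair_pair]

theorem mem_pair_part {f h : ℕ → Part ℕ} {n m : ℕ} :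
    m ∈ (Nat.pair <$> f n <*> h n) ↔ ∃ a b, (a ∈ f n ∧ b ∈ h n) ∧ Nat.pair a b = m := by
  simp only [Seq.seq, Part.map_eq_map, Part.mem_bind_iff, Part.mem_map_iff]
  constructor
  · rintro ⟨_, ⟨a, ha, rfl⟩, b, hb, rfl⟩
    exact ⟨a, b, ⟨ha, hb⟩, rfl⟩
  · rintro ⟨a, b, ⟨ha, hb⟩, rfl⟩
    exact ⟨_, ⟨a, ha, rfl⟩, b, hb, rfl⟩

theorem mem_rfind_zero {f : ℕ → Part ℕ} {a m : ℕ} :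
    (m ∈ Nat.rfind (fun n => (f (Nat.pair a n)).map fun m => decide (m = 0) : ℕ → Part Bool)) ↔
      0 ∈ f (Nat.pair a m) ∧ ∀ j, j < m → ∃ i, i ∈ f (Nat.pair a j) ∧ ¬ i = 0 := by
  refine Nat.mem_rfind.trans ?_
  simp only [Part.mem_map_iff]
  refine and_congr ⟨?_, fun h => ⟨0, h, by simp⟩⟩
    (forall_congr' fun j => imp_congr Iff.rfl ?_)
  · rintro ⟨i, hi, h⟩
    obtain rfl : i = 0 := by simpa using h
    exact hi
  · simp

/-- The functions recursive in `g` form the least family that contains `g` and is closed under the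
generating operations. One direction is induction on a derivation. -/
theorem turingReducible_iff_forall_closed (f g : ℕ →. ℕ) :
    TuringReducible f g ↔
      ∀ C, RecursivelyClosed C → partialGraph g ∈ C → partialGraph f ∈ C := by
  rw [TuringReducible, RecursiveIn.iff_nat]
  constructor
  · intro hf C ⟨⟨h1, h2⟩, h3, h4, h5⟩ hg
    induction hf with
    | zero =>
      refine (h1 _).1 fun n m => ?_
      exact Part.mem_some_iff
    | succ =>
      refine (h1 _).2.1 fun n m => ?_
      exact Part.mem_some_iff
    | left =>
      refine (h1 _).2.2.1 fun a b m => ?_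
      change m ∈ Part.some _ ↔ _
      rw [Nat.unpair_pair]
      exact Part.mem_some_iff
    | right =>
      refine (h1 _).2.2.2 fun a b m => ?_
      change m ∈ Part.some _ ↔ _
      rw [Nat.unpair_pair]
      exact Part.mem_some_iff
    | oracle g' hg' =>
      rw [Set.mem_singleton_iff.1 hg']
      exact hg
    | pair _ _ ihf ihh => exact h2 _ _ _ ihf ihh fun n m => mem_pair_part
    | comp _ _ ihf ihh => exact h3 _ _ _ ihf ihh fun n m => Part.mem_bind_iff
    | prec _ _ ihf ihh =>
      refine h4 _ _ _ ihf ihh (fun a m => ?_) fun a y m => ?_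
      · exact iff_of_eq (congrArg (m ∈ ·) (partialPrec_zero ..))
      · exact (iff_of_eq (congrArg (m ∈ ·) (partialPrec_succ ..))).trans Part.mem_bind_iff
    | rfind _ ihf => exact h5 _ _ ihf fun a m => mem_rfind_zero
  · intro h
    -- The converse tests the hypothesis on the family of graphs of functions recursive in `g`.
    have key : ∀ C : Set (Set (ℕ × ℕ)), C = partialGraph '' {f | Nat.RecursiveIn {g} f} →
        RecursivelyClosed C := by
      rintro C rfl
      refine ⟨⟨fun k => ⟨fun h => ?_, fun h => ?_, fun h => ?_, fun h => ?_⟩, ?_⟩, ?_, ?_, ?_⟩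
      · refine ⟨_, .zero, Set.ext fun ⟨n, m⟩ => ?_⟩
        exact Part.mem_some_iff.trans (h n m).symm
      · refine ⟨_, .succ, Set.ext fun ⟨n, m⟩ => ?_⟩
        exact Part.mem_some_iff.trans (h n m).symm
      · refine ⟨_, .left, Set.ext fun ⟨n, m⟩ => ?_⟩
        rw [← Nat.pair_unpair n, h]
        change m ∈ Part.some _ ↔ _
        rw [Nat.unpair_pair]
        exact Part.mem_some_iff
      · refine ⟨_, .right, Set.ext fun ⟨n, m⟩ => ?_⟩
        rw [← Nat.pair_unpair n, h]
        change m ∈ Part.some _ ↔ _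
        rw [Nat.unpair_pair]
        exact Part.mem_some_iff
      · rintro _ _ k ⟨f, hf, rfl⟩ ⟨h, hh, rfl⟩ hk
        refine ⟨_, .pair hf hh, Set.ext fun ⟨n, m⟩ => ?_⟩
        exact mem_pair_part.trans (hk n m).symm
      · rintro _ _ k ⟨f, hf, rfl⟩ ⟨h, hh, rfl⟩ hk
        refine ⟨_, .comp hf hh, Set.ext fun ⟨n, m⟩ => ?_⟩
        exact Part.mem_bind_iff.trans (hk n m).symm
      · rintro _ _ k ⟨f, hf, rfl⟩ ⟨h, hh, rfl⟩ hk0 hks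
        refine ⟨_, .prec hf hh, Set.ext fun ⟨n, m⟩ => ?_⟩
        rw [← Nat.pair_unpair n]
        generalize (Nat.unpair n).1 = a
        generalize (Nat.unpair n).2 = y
        induction y generalizing m with
        | zero =>
          exact (iff_of_eq (congrArg (m ∈ ·) (partialPrec_zero ..))).trans (hk0 ..).symm
        | succ y ih =>
          simp only [hks, ← ih]
          exact (iff_of_eq (congrArg (m ∈ ·) (partialPrec_succ ..))).trans Part.mem_bind_iff
      · rintro _ k ⟨f, hf, rfl⟩ hk
        refine ⟨_, .rfind hf, Set.ext fun ⟨n, m⟩ => ?_⟩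
        exact mem_rfind_zero.trans (hk n m).symm
    obtain ⟨f', hf', h'⟩ := h _ (key _ rfl) ⟨g, .oracle g rfl, rfl⟩
    rwa [← partialGraph_injective h']

/-! ### Definability of Turing degrees -/

section

variable {δ : Ordinal.{u}} [hδ : Fact (omegaOne < δ)] {Γ : Type v} [Context δ Γ]

set_option synthInstance.maxSize 2000 in
set_option synthInstance.maxHeartbeats 400000 in
instance DefinableFun.natPair {f g : Γ → ℕ} [hf : DefinableFun δ f] [hg : DefinableFun δ g] :
    DefinableFun δ fun γ => Nat.pair (f γ) (g γ) := by
  have h1 : DefinableFun δ fun q : Γ × ℕ => f q.1 := hf.weaken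
  have h2 : DefinableFun δ fun q : Γ × ℕ => g q.1 := hg.weaken
  have h3 : Definable δ fun q : Unit × Set (ℕ × (ℕ × ℕ)) => UnpairClosed q.2 := by
    unfold UnpairClosed
    infer_instance
  have h3' : Definable δ fun q : (((Unit × ℕ) × ℕ) × ℕ) × Set (ℕ × (ℕ × ℕ)) =>
    UnpairClosed q.2 := h3.comp _
  have h4 : Definable δ fun q : ((Unit × ℕ) × ℕ) × ℕ => Nat.pair q.1.1.2 q.1.2 = q.2 :=
    Definable.of_iff (P := fun q => ∀ C : Set (ℕ × (ℕ × ℕ)), UnpairClosed C →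
      (q.2, (q.1.1.2, q.1.2)) ∈ C) inferInstance fun q => (pair_eq_iff_forall_closed ..).symm
  exact ⟨h4.comp₃ (R := fun a b c => Nat.pair a b = c) (fun q : Γ × ℕ => f q.1)
    (fun q => g q.1) (fun q => q.2)⟩

set_option synthInstance.maxSize 2000 in
set_option synthInstance.maxHeartbeats 400000 in
theorem definable_recursivelyClosed :
    Definable δ fun q : Unit × Set (Set (ℕ × ℕ)) => RecursivelyClosed q.2 := by
  have h1 : Definable δ fun q : Unit × Set (Set (ℕ × ℕ)) => ContainsBasic q.2 := by
    unfold ContainsBasic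
    infer_instance
  have h2 : Definable δ fun q : Unit × Set (Set (ℕ × ℕ)) => ClosedPair q.2 := by
    unfold ClosedPair
    infer_instance
  have h3 : Definable δ fun q : Unit × Set (Set (ℕ × ℕ)) => ClosedComp q.2 := by
    unfold ClosedComp
    infer_instance
  have h4 : Definable δ fun q : Unit × Set (Set (ℕ × ℕ)) => ClosedPrec q.2 := by
    unfold ClosedPrec
    infer_instance
  have h5 : Definable δ fun q : Unit × Set (Set (ℕ × ℕ)) => ClosedFind q.2 := by
    unfold ClosedFind
    infer_instance
  unfold RecursivelyClosed
  infer_instance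

noncomputable instance : Coded δ Baire := inferInstanceAs (Coded δ (ℕ → ℕ))

instance : Quantifiable δ Baire := inferInstanceAs (Quantifiable δ (ℕ → ℕ))

theorem code_baire (x : Baire) : (code x : Level δ).1 = realCode x := by
  ext z
  rw [realCode, ZFSet.mem_range]
  refine (mem_code_set (δ := δ) (τ := ℕ × ℕ) (s := funGraph x)).trans ?_
  constructor
  · rintro ⟨⟨n, m⟩, h, rfl⟩
    obtain rfl := mem_funGraph.1 h
    exact ⟨n, rfl⟩
  · rintro ⟨n, rfl⟩
    exact ⟨(n, x n), rfl, rfl⟩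

/-- The graph of a real. -/
def Baire.graph (x : Baire) : Set (ℕ × ℕ) := funGraph x

theorem Baire.partialGraph_coe (x : Baire) :
    partialGraph (fun n => Part.some (x n)) = x.graph := LongGame.partialGraph_coe x

theorem Baire.graph_injective : Function.Injective Baire.graph := funGraph_injective

instance DefinableFun.baire_graph {f : Γ → Baire} [hf : DefinableFun δ f] :
    DefinableFun δ fun γ => (f γ).graph :=
  DefinableFun.funGraph_comp (τ := ℕ) (σ := ℕ) (f := f) (hf := hf)

instance Definable.baire_le {f g : Γ → Baire} [hf : DefinableFun δ f] [hg : DefinableFun δ g] :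
    Definable δ fun γ => f γ ≤ g γ := by
  have h1 : Definable δ fun q : ((Unit × Baire) × Baire) × Set (Set (ℕ × ℕ)) =>
    RecursivelyClosed q.2 := definable_recursivelyClosed.comp _
  have h2 : Definable δ fun q : (Unit × Baire) × Baire => q.1.2 ≤ q.2 :=
    Definable.of_iff (P := fun q => ∀ C : Set (Set (ℕ × ℕ)), RecursivelyClosed C →
      q.2.graph ∈ C → q.1.2.graph ∈ C) inferInstance fun q => by
        refine Iff.trans ?_ (turingReducible_iff_forall_closed _ _).symm
        exact forall_congr' fun C => imp_congr_right fun _ => by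
          rw [← Baire.partialGraph_coe, ← Baire.partialGraph_coe]
  exact h2.comp₂ (R := fun x y => x ≤ y) f g

/-- A Turing degree as an element of `V_δ`. -/
noncomputable def Level.degree (d : Degree) : Level δ :=
  ⟨degreeCode d, rank_lt_of_fact (rank_degreeCode_lt d).le⟩

theorem degree_eq_degree_iff {x y : Baire} : degree x = degree y ↔ x ≤ y ∧ y ≤ x :=
  Quotient.eq

/-- The degree is described by its elements, the codes of the reals equivalent to the given one. -/
instance DefinableFun.level_degree {f : Γ → Baire} [hf : DefinableFun δ f] :
    DefinableFun δ fun γ => (Level.degree (degree (f γ)) : Level δ) := by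
  have h1 : DefinableFun δ fun q : (Γ × Level δ) × Level δ => f q.1.1 := hf.weaken.weaken
  have h2 : DefinableFun δ fun q : ((Γ × Level δ) × Level δ) × Baire => f q.1.1.1 := h1.weaken
  refine ⟨Definable.of_iff (P := fun q => ∀ e : Level δ, e.1 ∈ q.2.1 ↔
    ∃ w : Baire, code w = e ∧ w ≤ f q.1 ∧ f q.1 ≤ w) inferInstance fun q => ?_⟩
  rw [eq_comm, Level.ext_iff']
  refine forall_congr' fun e => iff_congr Iff.rfl ?_
  simp only [Level.degree, degreeCode, ZFSet.mem_range, Subtype.exists, degree_eq_degree_iff,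
    Subtype.ext_iff, code_baire, exists_prop]
  exact exists_congr fun w => and_comm

end

/-! ### Positions in plays of length `ω₁` -/

/-- The position `ω * (2 + α)`. -/
noncomputable def blockStart (α : Set.Iio omegaOne.{u}) : Set.Iio omegaOne.{u} :=
  ⟨Ordinal.omega0 * (2 + α.1), Ordinal.isPrincipal_mul_omega 1 omega0_lt_omegaOne
    (Ordinal.isPrincipal_add_omega 1
      ((Ordinal.natCast_lt_omega0 2).trans omega0_lt_omegaOne) α.2)⟩

/-- The position `α + n`. -/
noncomputable def addNat (α : Set.Iio omegaOne.{u}) (n : ℕ) : Set.Iio omegaOne.{u} :=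
  ⟨α.1 + n, Ordinal.isPrincipal_add_omega 1 α.2
    ((Ordinal.natCast_lt_omega0 n).trans omega0_lt_omegaOne)⟩

noncomputable def zeroPos : Set.Iio omegaOne.{u} := ⟨0, Ordinal.omega_pos 1⟩

noncomputable def omegaPos : Set.Iio omegaOne.{u} := ⟨Ordinal.omega0, omega0_lt_omegaOne⟩

/-- The position `ω + 1`. -/
noncomputable def sidePos : Set.Iio omegaOne.{u} := ⟨Ordinal.omega0 + 1, omega0_add_one_lt_omegaOne⟩

theorem addNat_zero (α : Set.Iio omegaOne.{u}) : addNat α 0 = α := Subtype.ext (by simp [addNat])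

theorem covBy_iff_eq_addNat {α β : Set.Iio omegaOne.{u}} : α ⋖ β ↔ β = addNat α 1 := by
  constructor
  · intro h
    refine le_antisymm ?_ ?_
    · by_contra hlt
      exact h.2 (c := addNat α 1) (Subtype.mk_lt_mk.2 (by simp)) (not_le.1 hlt)
    · change α.1 + ((1 : ℕ) : Ordinal) ≤ β.1
      rw [Nat.cast_one]
      exact Order.add_one_le_of_lt h.1
  · rintro rfl
    refine ⟨Subtype.mk_lt_mk.2 (by simp), fun c h1 h2 => ?_⟩
    have h2' : c.1 < α.1 + ((1 : ℕ) : Ordinal) := h2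
    rw [Nat.cast_one, Order.lt_add_one_iff] at h2'
    exact absurd h1 (not_lt.2 h2')

theorem addNat_addNat (α : Set.Iio omegaOne.{u}) (m n : ℕ) :
    addNat (addNat α m) n = addNat α (m + n) := Subtype.ext (by simp [addNat, add_assoc])

theorem blockStart_lt_iff {α β : Set.Iio omegaOne.{u}} : blockStart α < blockStart β ↔ α < β := by
  rw [← Subtype.coe_lt_coe, blockStart, blockStart, ← Subtype.coe_lt_coe]
  simp [Ordinal.omega0_pos]

theorem blockStart_injective : Function.Injective (blockStart.{u}) :=
  (StrictMono.injective fun _ _ h => blockStart_lt_iff.2 h)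

/-- Limit positions above `ω`. -/
def IsBlockStart (μ : Set.Iio omegaOne.{u}) : Prop :=
  omegaPos < μ ∧ ∀ ν : Set.Iio omegaOne.{u}, ν < μ → ∃ ν' : Set.Iio omegaOne.{u}, ν' < μ ∧ ν < ν'

/-- Limits are the multiples `ω * c`; above `ω` this forces `2 ≤ c`, and then `c = 2 + (c - 2)`. -/
theorem isBlockStart_iff {μ : Set.Iio omegaOne.{u}} :
    IsBlockStart μ ↔ ∃ α, blockStart α = μ := by
  constructor
  · rintro ⟨h1, h2⟩
    have hlim : Order.IsSuccPrelimit μ.1 := by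
      refine Order.isSuccPrelimit_of_succ_lt fun a ha => ?_
      obtain ⟨ν, hν, hν'⟩ := h2 ⟨a, ha.trans μ.2⟩ ha
      exact (Order.succ_le_of_lt (show a < ν.1 from hν')).trans_lt hν
    obtain ⟨c, hc⟩ := Ordinal.isSuccPrelimit_iff_omega0_dvd.1 hlim
    have h1' : Ordinal.omega0 * 1 < Ordinal.omega0 * c := by
      rw [← hc, mul_one]
      exact h1
    have hc1 : 1 < c := lt_of_mul_lt_mul_left h1' zero_le
    have hc2 : 2 ≤ c := by
      rw [← one_add_one_eq_two]
      exact Order.add_one_le_of_lt hc1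
    have hcμ : c ≤ μ.1 := by
      rw [hc]
      exact Ordinal.le_mul_right c Ordinal.omega0_pos
    refine ⟨⟨c - 2, ((Ordinal.sub_le_self _ _).trans hcμ).trans_lt μ.2⟩, Subtype.ext ?_⟩
    exact (congrArg _ (Ordinal.add_sub_cancel_of_le hc2)).trans hc.symm
  · rintro ⟨α, rfl⟩
    constructor
    · change Ordinal.omega0 < Ordinal.omega0 * (2 + α.1)
      conv_lhs => rw [← mul_one Ordinal.omega0]
      refine mul_lt_mul_of_pos_left ?_ Ordinal.omega0_pos
      exact lt_of_lt_of_le (by exact_mod_cast one_lt_two) le_self_add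
    · intro ν hν
      refine ⟨addNat ν 1, ?_, Subtype.mk_lt_mk.2 (by simp)⟩
      have : Order.IsSuccPrelimit (blockStart α).1 :=
        Ordinal.isSuccPrelimit_iff_omega0_dvd.2 ⟨_, rfl⟩
      change ν.1 + ((1 : ℕ) : Ordinal) < _
      rw [Nat.cast_one]
      exact this.add_one_lt hν

/-- Relations between positions and starting points of blocks that respect the order
in both directions. -/
def IsBlockRelation (G : Set (Set.Iio omegaOne.{u} × Set.Iio omegaOne.{u})) : Prop :=
  ∀ β μ : Set.Iio omegaOne.{u}, (β, μ) ∈ G → IsBlockStart μ ∧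
    (∀ γ : Set.Iio omegaOne.{u}, γ < β → ∃ ν : Set.Iio omegaOne.{u}, ν < μ ∧ (γ, ν) ∈ G) ∧
    ∀ ν : Set.Iio omegaOne.{u}, ν < μ → IsBlockStart ν →
      ∃ γ : Set.Iio omegaOne.{u}, γ < β ∧ (γ, ν) ∈ G

/-- `blockStart` enumerates the limits above `ω` in increasing order. A back-and-forth relation can
only be part of this enumeration, by induction on `α`; so no ordinal arithmetic has to be defined.
-/
theorem blockStart_eq_iff {α μ : Set.Iio omegaOne.{u}} :
    blockStart α = μ ↔ ∃ G, IsBlockRelation G ∧ (α, μ) ∈ G := by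
  constructor
  · rintro rfl
    refine ⟨funGraph blockStart, fun β μ hμ => ?_, rfl⟩
    obtain rfl := mem_funGraph.1 hμ
    refine ⟨isBlockStart_iff.2 ⟨β, rfl⟩, fun γ hγ => ⟨_, blockStart_lt_iff.2 hγ, rfl⟩, ?_⟩
    intro ν hν h
    obtain ⟨γ, rfl⟩ := isBlockStart_iff.1 h
    exact ⟨γ, blockStart_lt_iff.1 hν, rfl⟩
  · rintro ⟨G, hG, h⟩
    induction α using WellFoundedLT.induction generalizing μ with
    | ind α ih =>
      obtain ⟨h1, h2, h3⟩ := hG _ _ h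
      obtain ⟨γ, rfl⟩ := isBlockStart_iff.1 h1
      rcases lt_trichotomy γ α with hlt | rfl | hlt
      · obtain ⟨ν, hν, hν'⟩ := h2 γ hlt
        rw [ih γ hlt hν'] at hν
        exact absurd hν (lt_irrefl _)
      · rfl
      · obtain ⟨β, hβ, hβ'⟩ := h3 _ (blockStart_lt_iff.2 hlt) (isBlockStart_iff.2 ⟨α, rfl⟩)
        exact absurd (blockStart_injective (ih β hβ hβ')) hβ.ne

/-- Addition of `n` as `n` passages to the immediate successor; the next lemma takes two at a time.
-/
theorem addNat_eq_iff {α β : Set.Iio omegaOne.{u}} {n : ℕ} :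
    addNat α n = β ↔ ∀ C : Set (ℕ × Set.Iio omegaOne.{u}), (0, α) ∈ C →
      (∀ (m : ℕ) (ξ ζ : Set.Iio omegaOne.{u}), (m, ξ) ∈ C → ξ ⋖ ζ → (m + 1, ζ) ∈ C) →
      (n, β) ∈ C := by
  constructor
  · rintro rfl C h0 hs
    induction n with
    | zero => rwa [addNat_zero]
    | succ n ih => exact hs _ _ _ ih (covBy_iff_eq_addNat.2 (addNat_addNat ..).symm)
  · intro h
    refine h (funGraph (addNat α) ∘ id) (addNat_zero α) fun m ξ ζ hξ hζ => ?_
    obtain rfl := mem_funGraph.1 hξ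
    rw [covBy_iff_eq_addNat.1 hζ]
    exact (addNat_addNat ..).symm

theorem addNat_double_eq_iff {α β : Set.Iio omegaOne.{u}} {n : ℕ} :
    addNat α (2 * n) = β ↔ ∀ C : Set (ℕ × Set.Iio omegaOne.{u}), (0, α) ∈ C →
      (∀ (m : ℕ) (ξ ζ η : Set.Iio omegaOne.{u}), (m, ξ) ∈ C → ξ ⋖ ζ → ζ ⋖ η → (m + 1, η) ∈ C) →
      (n, β) ∈ C := by
  constructor
  · rintro rfl C h0 hs
    induction n with
    | zero => rwa [mul_zero, addNat_zero]
    | succ n ih =>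
      exact hs _ _ _ _ ih (covBy_iff_eq_addNat.2 (addNat_addNat α (2 * n) 1).symm)
        (covBy_iff_eq_addNat.2 (addNat_addNat α (2 * n + 1) 1).symm)
  · intro h
    refine h (funGraph fun n => addNat α (2 * n)) (addNat_zero α) fun m ξ ζ η hξ hζ hη => ?_
    obtain rfl := mem_funGraph.1 hξ
    rw [covBy_iff_eq_addNat.1 hη, covBy_iff_eq_addNat.1 hζ, addNat_addNat, addNat_addNat]
    rfl

/-! ### The data coded by a play -/

/-- The real played by the first player in the first `ω` moves. -/
noncomputable def firstReal (x : LongSeq.{u} ℕ) : Baire := fun n => x (addNat zeroPos (2 * n))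

/-- The real consisting of the `ω` moves from `ω * (2 + α)` on. -/
noncomputable def blockReal (x : LongSeq.{u} ℕ) (α : Set.Iio omegaOne.{u}) : Baire :=
  fun n => x (addNat (blockStart α) n)

/-- The degrees of the reals consisting of `ω` consecutive moves, from `ω * 2` on. -/
noncomputable def blockDegrees (x : LongSeq.{u} ℕ) : LongSeq.{u} Degree :=
  fun α => degree (blockReal x α)

/-- The second player chooses a side at `ω + 1`, and wins if the truth value of the formula
for the coded data is on that side. -/
def sidePayoff {δ : Ordinal.{u}} (hδ : omegaOne < δ) (φ : setLanguage.Formula (Fin 2)) :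
    Set (LongSeq.{u} ℕ) :=
  {x | ¬ (x sidePos = 0 ↔
    φ.Realize ![Level.real hδ (firstReal x), Level.degreeSeq hδ (blockDegrees x)])}

/-! ### Definability of the payoff -/

section

variable {δ : Ordinal.{u}} [hδ : Fact (omegaOne < δ)] {Γ : Type v} [Context δ Γ]

instance DefinableFun.omegaPos_const : DefinableFun δ fun _ : Γ => omegaPos.{u} :=
  ⟨(Definable.eq_param (δ := δ) (Γ := Γ × Set.Iio omegaOne.{u}) (Sum.inr ()) 0).of_iff fun q =>
    (code_injective (δ := δ)).eq_iff (a := omegaPos) (b := q.2)⟩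

instance DefinableFun.sidePos_const : DefinableFun δ fun _ : Γ => sidePos.{u} :=
  ⟨(Definable.eq_param (δ := δ) (Γ := Γ × Set.Iio omegaOne.{u}) (Sum.inr ()) 2).of_iff fun q =>
    (code_injective (δ := δ)).eq_iff (a := sidePos) (b := q.2)⟩

instance DefinableFun.zeroPos_const : DefinableFun δ fun _ : Γ => zeroPos.{u} :=
  ⟨Definable.of_iff (P := fun q => ∀ ζ : Set.Iio omegaOne.{u}, ¬ ζ < q.2) inferInstance fun q =>
    ⟨fun h => Subtype.ext (zero_le.antisymm (not_lt.1 (h zeroPos))), fun h ζ => by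
      rw [← h]
      exact fun h' => absurd (show ζ.1 < 0 from h') not_lt_zero⟩⟩

instance DefinableFun.blockStart_comp {f : Γ → Set.Iio omegaOne.{u}} [hf : DefinableFun δ f] :
    DefinableFun δ fun γ => blockStart (f γ) := by
  have h1 : DefinableFun δ fun q : Γ × Set.Iio omegaOne.{u} => f q.1 := hf.weaken
  have h2 : Definable δ fun q : Unit × Set.Iio omegaOne.{u} => IsBlockStart q.2 := by
    unfold IsBlockStart
    infer_instance
  have h2' : ∀ {Γ' : Type (u + 1)} [Context δ Γ'] {g : Γ' → Set.Iio omegaOne.{u}}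
    [DefinableFun δ g], Definable δ fun γ => IsBlockStart (g γ) := h2.comp _
  have h3 : Definable δ fun q : Unit × Set (Set.Iio omegaOne.{u} × Set.Iio omegaOne.{u}) =>
      IsBlockRelation q.2 := by
    unfold IsBlockRelation
    infer_instance
  have h3' := h3.comp (fun q : ((Unit × Set.Iio omegaOne.{u}) × Set.Iio omegaOne.{u}) ×
    Set (Set.Iio omegaOne.{u} × Set.Iio omegaOne.{u}) => q.2)
  have h4 : Definable δ fun q : (Unit × Set.Iio omegaOne.{u}) × Set.Iio omegaOne.{u} =>
      blockStart q.1.2 = q.2 :=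
    Definable.of_iff (P := fun q => ∃ G : Set (Set.Iio omegaOne.{u} × Set.Iio omegaOne.{u}),
      IsBlockRelation G ∧ (q.1.2, q.2) ∈ G) inferInstance fun q => blockStart_eq_iff.symm
  exact ⟨h4.comp₂ (R := fun a b => blockStart a = b) (fun q : Γ × Set.Iio omegaOne.{u} => f q.1)
    (fun q => q.2)⟩

instance DefinableFun.addNat_comp {f : Γ → Set.Iio omegaOne.{u}} {g : Γ → ℕ}
    [hf : DefinableFun δ f] [hg : DefinableFun δ g] :
    DefinableFun δ fun γ => addNat (f γ) (g γ) := by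
  have h1 : DefinableFun δ fun q : Γ × Set.Iio omegaOne.{u} => f q.1 := hf.weaken
  have h2 : DefinableFun δ fun q : Γ × Set.Iio omegaOne.{u} => g q.1 := hg.weaken
  have h3 : Definable δ fun q : ((Unit × Set.Iio omegaOne.{u}) × ℕ) × Set.Iio omegaOne.{u} =>
      addNat q.1.1.2 q.1.2 = q.2 :=
    Definable.of_iff (P := fun q => ∀ C : Set (ℕ × Set.Iio omegaOne.{u}), (0, q.1.1.2) ∈ C →
      (∀ (m : ℕ) (ξ ζ : Set.Iio omegaOne.{u}), (m, ξ) ∈ C → ξ ⋖ ζ → (m + 1, ζ) ∈ C) →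
      (q.1.2, q.2) ∈ C) inferInstance fun q => addNat_eq_iff.symm
  exact ⟨h3.comp₃ (R := fun a b c => addNat a b = c)
    (fun q : Γ × Set.Iio omegaOne.{u} => f q.1) (fun q => g q.1) (fun q => q.2)⟩

instance DefinableFun.addNat_double {f : Γ → Set.Iio omegaOne.{u}} {g : Γ → ℕ}
    [hf : DefinableFun δ f] [hg : DefinableFun δ g] :
    DefinableFun δ fun γ => addNat (f γ) (2 * g γ) := by
  have h1 : DefinableFun δ fun q : Γ × Set.Iio omegaOne.{u} => f q.1 := hf.weaken
  have h2 : DefinableFun δ fun q : Γ × Set.Iio omegaOne.{u} => g q.1 := hg.weaken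
  have h3 : Definable δ fun q : ((Unit × Set.Iio omegaOne.{u}) × ℕ) × Set.Iio omegaOne.{u} =>
      addNat q.1.1.2 (2 * q.1.2) = q.2 :=
    Definable.of_iff (P := fun q => ∀ C : Set (ℕ × Set.Iio omegaOne.{u}), (0, q.1.1.2) ∈ C →
      (∀ (m : ℕ) (ξ ζ η : Set.Iio omegaOne.{u}),
        (m, ξ) ∈ C → ξ ⋖ ζ → ζ ⋖ η → (m + 1, η) ∈ C) →
      (q.1.2, q.2) ∈ C) inferInstance fun q => addNat_double_eq_iff.symm
  exact ⟨h3.comp₃ (R := fun a b c => addNat a (2 * b) = c)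
    (fun q : Γ × Set.Iio omegaOne.{u} => f q.1) (fun q => g q.1) (fun q => q.2)⟩

instance DefinableFun.firstReal_comp {f : Γ → LongSeq.{u} ℕ} [hf : DefinableFun δ f] :
    DefinableFun δ fun γ => firstReal (f γ) := by
  have h1 : DefinableFun δ fun q : Γ × Baire => f q.1 := hf.weaken
  have h2 : Definable δ fun q : (Unit × LongSeq.{u} ℕ) × Baire => firstReal q.1.2 = q.2 :=
    Definable.of_iff (P := fun q => ∀ n m : ℕ, (n, m) ∈ q.2.graph ↔
      (addNat zeroPos (2 * n), m) ∈ funGraph q.1.2) inferInstance fun q => by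
        constructor
        · intro h
          exact Baire.graph_injective (Set.ext fun p => (h p.1 p.2).symm)
        · intro h n m
          rw [← h]
          rfl
  exact ⟨h2.comp₂ (R := fun a b => firstReal a = b) (fun q : Γ × Baire => f q.1) (fun q => q.2)⟩

instance DefinableFun.blockReal_comp {f : Γ → LongSeq.{u} ℕ} {g : Γ → Set.Iio omegaOne.{u}}
    [hf : DefinableFun δ f] [hg : DefinableFun δ g] :
    DefinableFun δ fun γ => blockReal (f γ) (g γ) := by
  have h1 : DefinableFun δ fun q : Γ × Baire => f q.1 := hf.weaken
  have h1' : DefinableFun δ fun q : Γ × Baire => g q.1 := hg.weaken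
  have h2 : Definable δ fun q : ((Unit × LongSeq.{u} ℕ) × Set.Iio omegaOne.{u}) × Baire =>
      blockReal q.1.1.2 q.1.2 = q.2 :=
    Definable.of_iff (P := fun q => ∀ n m : ℕ, (n, m) ∈ q.2.graph ↔
      (addNat (blockStart q.1.2) n, m) ∈ funGraph q.1.1.2) inferInstance fun q => by
        constructor
        · intro h
          exact Baire.graph_injective (Set.ext fun p => (h p.1 p.2).symm)
        · intro h n m
          rw [← h]
          rfl
  exact ⟨h2.comp₃ (R := fun a b c => blockReal a b = c) (fun q : Γ × Baire => f q.1)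
    (fun q => g q.1) (fun q => q.2)⟩

theorem code_eq_real (x : Baire) : (code x : Level δ) = Level.real hδ.out x :=
  Subtype.ext (code_baire x)

theorem code_eq_natSeq (x : LongSeq.{u} ℕ) : (code x : Level δ) = Level.natSeq hδ.out x := by
  refine Subtype.ext (ZFSet.ext fun z => ?_)
  rw [code_fun_eq, mem_code_set]
  refine Iff.trans ?_ (ZFSet.mem_range (f := fun α : Set.Iio omegaOne.{u} =>
    ZFSet.pair α.1.toZFSet (natCode (x α)))).symm
  constructor
  · rintro ⟨⟨α, m⟩, h, rfl⟩
    obtain rfl := mem_funGraph.1 h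
    exact ⟨α, rfl⟩
  · rintro ⟨α, rfl⟩
    exact ⟨(α, x α), rfl, rfl⟩

instance DefinableFun.degreeSeq_comp :
    DefinableFun δ fun q : Unit × LongSeq.{u} ℕ => Level.degreeSeq hδ.out (blockDegrees q.2) :=
  ⟨Definable.of_iff (P := fun q => ∀ p : Level δ, p.1 ∈ q.2.1 ↔ ∃ α : Set.Iio omegaOne.{u},
    p.1 = ZFSet.pair (code α : Level δ).1
      (Level.degree (degree (blockReal q.1.2 α)) : Level δ).1) inferInstance fun q => by
    rw [eq_comm, Level.ext_iff']
    refine forall_congr' fun p => iff_congr Iff.rfl ?_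
    refine Iff.trans ?_ (ZFSet.mem_range (f := fun α : Set.Iio omegaOne.{u} =>
      ZFSet.pair α.1.toZFSet (degreeCode (blockDegrees q.1.2 α)))).symm
    exact exists_congr fun α => eq_comm⟩

theorem definable_realize (φ : setLanguage.Formula (Fin 2)) :
    Definable δ fun q : (Unit × Level δ) × Level δ => φ.Realize ![q.1.2, q.2] := by
  refine ⟨φ.relabel ![Sum.inr (Sum.inl (Sum.inr ())), Sum.inr (Sum.inr ())], fun q => ?_⟩
  rw [FirstOrder.Language.Formula.realize_relabel]
  refine iff_of_eq (congrArg _ ?_)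
  funext i
  fin_cases i <;> rfl

theorem definable_sidePayoff (φ : setLanguage.Formula (Fin 2)) :
    Definable δ fun q : Unit × LongSeq.{u} ℕ => q.2 ∈ sidePayoff hδ.out φ := by
  have h1 := (definable_realize (δ := δ) φ).comp₂ (R := fun a b => φ.Realize ![a, b])
    (fun q : Unit × LongSeq.{u} ℕ => code (firstReal q.2))
    (fun q => Level.degreeSeq hδ.out (blockDegrees q.2))
  exact Definable.of_iff (P := fun q : Unit × LongSeq.{u} ℕ => ¬ ((sidePos, 0) ∈ funGraph q.2 ↔
    φ.Realize ![code (firstReal q.2), Level.degreeSeq hδ.out (blockDegrees q.2)])) inferInstance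
      fun q => by rw [code_eq_real]; rfl

/-- The witness is `θ = δ`, with the ordinals `ω`, `ω₁` and `ω + 1`; the play becomes variable `0`.
-/
theorem Definable.ordinalDefinable {A : Set (LongSeq.{u} ℕ)}
    (h : Definable δ fun q : Unit × LongSeq.{u} ℕ => q.2 ∈ A) : OrdinalDefinable A := by
  obtain ⟨φ, hφ⟩ := h
  refine ⟨δ, hδ.out, 3, ordinalParams δ,
    φ.relabel (Sum.elim Fin.succ (Sum.elim Empty.elim fun _ => 0)), fun x => ?_⟩
  rw [FirstOrder.Language.Formula.realize_relabel, ← hφ ((), x)]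
  refine iff_of_eq (congrArg _ ?_)
  funext i
  rcases i with i | i | i
  · rfl
  · exact i.elim
  · exact code_eq_natSeq x

end

theorem ordinalDefinable_sidePayoff {δ : Ordinal.{u}} (hδ : omegaOne < δ)
    (φ : setLanguage.Formula (Fin 2)) : OrdinalDefinable (sidePayoff hδ φ) :=
  have : Fact (omegaOne < δ) := ⟨hδ⟩
  (definable_sidePayoff φ).ordinalDefinable

/-! ### Turing reducibility of reals -/

/-- Total functions recursive in a real. -/
def RecursiveInReal (y : Baire) (f : ℕ → ℕ) : Prop :=
  Nat.RecursiveIn {fun n => Part.some (y n)} fun n => Part.some (f n)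

theorem baire_le_iff {x y : Baire} : x ≤ y ↔ RecursiveInReal y x := RecursiveIn.iff_nat

namespace RecursiveInReal

variable {y : Baire} {f g : ℕ → ℕ}

theorem oracle : RecursiveInReal y y := Nat.RecursiveIn.oracle _ rfl

theorem congr (hf : RecursiveInReal y f) (h : ∀ n, f n = g n) : RecursiveInReal y g :=
  (funext h : f = g) ▸ hf

theorem of_primrec (hf : Primrec f) : RecursiveInReal y f :=
  (Primrec.nat_iff.1 hf).recursiveIn

theorem comp (hf : RecursiveInReal y f) (hg : RecursiveInReal y g) :
    RecursiveInReal y fun n => f (g n) :=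
  (Nat.RecursiveIn.comp hf hg).of_eq fun _ => Part.bind_some _ _

theorem pair (hf : RecursiveInReal y f) (hg : RecursiveInReal y g) :
    RecursiveInReal y fun n => Nat.pair (f n) (g n) :=
  (Nat.RecursiveIn.pair hf hg).of_eq fun n => by simp [Seq.seq]

theorem prec {h : ℕ → ℕ} {a : ℕ} (hg : RecursiveInReal y g) (h0 : h 0 = a)
    (hs : ∀ n, h (n + 1) = g (Nat.pair n (h n))) : RecursiveInReal y h := by
  have h1 : RecursiveInReal y fun _ => a := of_primrec (.const a)
  have h2 : RecursiveInReal y fun p => g (Nat.unpair p).2 :=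
    hg.comp (of_primrec (Primrec.snd.comp Primrec.unpair))
  have h3 := Nat.RecursiveIn.comp (Nat.RecursiveIn.prec h1 h2)
    (of_primrec (y := y) (f := fun n => Nat.pair 0 n)
      (Primrec₂.natPair.comp (.const 0) .id))
  refine h3.of_eq fun n => ?_
  refine (Part.bind_some _ _).trans ?_
  simp only [Nat.unpair_pair]
  induction n with
  | zero => exact congrArg Part.some h0.symm
  | succ n ih =>
    rw [hs]
    simp only [ih]
    exact (Part.bind_some _ _)

end RecursiveInReal

/-- A number coding the first `n` values of a real. -/
def history (y : Baire) : ℕ → ℕ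
  | 0 => 0
  | n + 1 => Nat.pair (y n) (history y n)

theorem history_eq_iff {x y : Baire} {n : ℕ} :
    history x n = history y n ↔ ∀ k < n, x k = y k := by
  induction n with
  | zero => simp [history]
  | succ n ih =>
    rw [history, history, Nat.pair_eq_pair, ih]
    constructor
    · rintro ⟨h1, h2⟩ k hk
      rcases (Nat.lt_succ_iff.1 hk).lt_or_eq with h | rfl
      · exact h2 k h
      · exact h1
    · exact fun h => ⟨h n (Nat.lt_succ_self n), fun k hk => h k (hk.trans (Nat.lt_succ_self n))⟩

/-- If every other term of `z` is read off `y`, and the remaining terms are computed by a real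
below `y` from the history of `y`, then `z` has the degree of `y`. -/
theorem degree_eq_of_interleave {t y z : Baire} {b : Prop} (ht : t ≤ y)
    (h1 : ∀ n, (Even n ↔ b) → z n = t (Nat.pair n (history y n)))
    (h2 : ∀ n, ¬ (Even n ↔ b) → z n = y (n / 2)) : degree z = degree y := by
  classical
  rw [degree_eq_degree_iff]
  constructor
  · rw [baire_le_iff] at ht ⊢
    have hh : RecursiveInReal y (history y) := by
      refine RecursiveInReal.prec (g := fun p => Nat.pair (y (Nat.unpair p).1) (Nat.unpair p).2)
        ?_ (a := 0) rfl fun n => ?_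
      · exact (RecursiveInReal.oracle.comp (.of_primrec (Primrec.fst.comp Primrec.unpair))).pair
          (.of_primrec (Primrec.snd.comp Primrec.unpair))
      · rw [Nat.unpair_pair]
        rfl
    have hid : RecursiveInReal y fun n => n := .of_primrec .id
    have hA : RecursiveInReal y fun n => t (Nat.pair n (history y n)) := ht.comp (hid.pair hh)
    have hB : RecursiveInReal y fun n => y (n / 2) :=
      RecursiveInReal.oracle.comp (.of_primrec (Primrec.nat_div.comp .id (.const 2)))
    -- The parity of the place decides whether `z` shows the computed term or the term of `y`.
    let F : ℕ → ℕ := fun p => if (Nat.unpair p).1 % 2 = (if b then 0 else 1)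
      then (Nat.unpair (Nat.unpair p).2).1 else (Nat.unpair (Nat.unpair p).2).2
    have hF : Primrec F := by
      have hs : Primrec fun p : ℕ => Nat.unpair (Nat.unpair p).2 :=
        Primrec.unpair.comp (Primrec.snd.comp Primrec.unpair)
      refine Primrec.ite ?_ (Primrec.fst.comp hs) (Primrec.snd.comp hs)
      exact Primrec.eq.comp (Primrec.nat_mod.comp (Primrec.fst.comp Primrec.unpair) (.const 2))
        (.const _)
    have hz := (RecursiveInReal.of_primrec hF).comp (hid.pair (hA.pair hB))
    refine hz.congr fun n => ?_
    have key : n % 2 = (if b then 0 else 1) ↔ (Even n ↔ b) := by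
      by_cases hb : b <;> simp [hb, Nat.even_iff]
    by_cases h : Even n ↔ b
    · simp only [F, Nat.unpair_pair, if_pos (key.2 h), h1 n h]
    · simp only [F, Nat.unpair_pair, if_neg (key.not.2 h), h2 n h]
  · rw [baire_le_iff]
    -- Conversely `y` is recovered from the odd places if `b` holds, from the even ones otherwise.
    by_cases hb : b
    · have : RecursiveInReal z fun k => z (2 * k + 1) := RecursiveInReal.oracle.comp
        (.of_primrec (Primrec.succ.comp (Primrec.nat_mul.comp (.const 2) .id)))
      refine this.congr fun k => ?_
      rw [h2 _ (by simp [hb])]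
      congr 1
      omega
    · have : RecursiveInReal z fun k => z (2 * k) := RecursiveInReal.oracle.comp
        (.of_primrec (Primrec.nat_mul.comp (.const 2) .id))
      refine this.congr fun k => ?_
      rw [h2 _ (by simp [hb])]
      congr 1
      omega

/-- Countably many Turing degrees have an upper bound. -/
theorem exists_degree_upper_bound {ι : Type*} [Countable ι] (d : ι → Degree) :
    ∃ D, ∀ i, d i ≤ D := by
  rcases isEmpty_or_nonempty ι with hι | hι
  · exact ⟨degree fun _ => 0, fun i => hι.elim i⟩
  obtain ⟨e, he⟩ := exists_surjective_nat ι
  have hx : ∀ n, ∃ x : Baire, degree x = d (e n) := fun n => Quotient.exists_rep _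
  choose x hx using hx
  -- The join of representatives, with the `n`-th one as the `n`-th column.
  let y : Baire := fun p => x (Nat.unpair p).1 (Nat.unpair p).2
  refine ⟨degree y, fun i => ?_⟩
  obtain ⟨n, rfl⟩ := he i
  rw [← hx]
  change x n ≤ y
  rw [baire_le_iff]
  have : RecursiveInReal y fun k => y (Nat.pair n k) := RecursiveInReal.oracle.comp
    (.of_primrec (Primrec₂.natPair.comp (.const n) .id))
  refine this.congr fun k => ?_
  simp [y]

/-! ### Plays against a strategy -/

theorem isEven_iff (β : Ordinal.{u}) (n : ℕ) : IsEven (Ordinal.omega0 * β + n) ↔ Even n := by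
  constructor
  · rintro ⟨γ, m, h⟩
    have h' := congrArg (· % Ordinal.omega0) h
    simp only [Ordinal.mul_add_mod_self, Ordinal.mod_eq_of_lt (Ordinal.natCast_lt_omega0 _)] at h'
    rw [Nat.cast_inj.1 h']
    exact even_two_mul m
  · rintro ⟨m, rfl⟩
    exact ⟨β, m, by rw [two_mul]⟩

/-- The positions of the first player if `b` holds, and of the second player otherwise. -/
def turn (b : Prop) : Set (Set.Iio omegaOne.{u}) := {α | IsEven α.1 ↔ b}

theorem addNat_blockStart_mem_turn {b : Prop} {α : Set.Iio omegaOne.{u}} {n : ℕ} :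
    addNat (blockStart α) n ∈ turn b ↔ (Even n ↔ b) :=
  iff_congr (isEven_iff _ n) Iff.rfl

theorem addNat_zeroPos_mem_turn {b : Prop} {n : ℕ} :
    addNat (zeroPos.{u}) n ∈ turn b ↔ (Even n ↔ b) := by
  refine iff_congr ?_ Iff.rfl
  rw [← isEven_iff 0 n, mul_zero]
  rfl

theorem sidePos_mem_turn {b : Prop} : sidePos.{u} ∈ turn b ↔ ¬ b := by
  have h := isEven_iff.{u} 1 1
  rw [mul_one, Nat.cast_one] at h
  change (IsEven (Ordinal.omega0 + 1) ↔ b) ↔ _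
  rw [h]
  simp

/-- The play in which the moves at the positions in `G` are made by the strategy, and the
other moves are given. -/
noncomputable def play (G : Set (Set.Iio omegaOne.{u})) (ρ : Strategy.{u}) (m : LongSeq.{u} ℕ) :
    LongSeq.{u} ℕ :=
  open scoped Classical in
  WellFoundedLT.fix fun α ih =>
    if α ∈ G then ρ ⟨α, fun γ => ih ⟨γ.1, lt_trans (Set.mem_Iio.1 γ.2) (Set.mem_Iio.1 α.2)⟩ γ.2⟩
    else m α

section

variable {G : Set (Set.Iio omegaOne.{u})} {ρ : Strategy.{u}} {m m' : LongSeq.{u} ℕ}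
  {α : Set.Iio omegaOne.{u}}

theorem play_of_mem (h : α ∈ G) : play G ρ m α = ρ ((play G ρ m).restrict α) := by
  conv_lhs => rw [play, WellFoundedLT.fix_eq, if_pos h]
  rfl

theorem play_of_notMem (h : α ∉ G) : play G ρ m α = m α := by
  rw [play, WellFoundedLT.fix_eq, if_neg h]

/-- By induction along the play: the strategy's moves see the given moves only through earlier
positions outside `G`. -/
theorem play_congr (h : ∀ γ ≤ α, γ ∉ G → m γ = m' γ) : play G ρ m α = play G ρ m' α := by
  induction α using WellFoundedLT.induction with
  | ind α ih =>
    by_cases hα : α ∈ G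
    · rw [play_of_mem hα, play_of_mem hα]
      have : (play G ρ m).restrict α = (play G ρ m').restrict α := by
        refine congrArg (Sigma.mk α) (funext fun γ => ?_)
        exact ih _ γ.2 fun ζ hζ => h ζ (hζ.trans (le_of_lt γ.2))
      rw [this]
    · rw [play_of_notMem hα, play_of_notMem hα]
      exact h α le_rfl hα

end

/-! ### Playing prescribed reals into the blocks -/

theorem addNat_blockStart_lt {α β : Set.Iio omegaOne.{u}} (h : α < β) (m n : ℕ) :
    addNat (blockStart α) m < addNat (blockStart β) n := by
  change Ordinal.omega0 * (2 + α.1) + m < Ordinal.omega0 * (2 + β.1) + n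
  have h1 : (2 + α.1) + 1 ≤ 2 + β.1 :=
    Order.add_one_le_of_lt ((add_lt_add_iff_left 2).2 (show α.1 < β.1 from h))
  calc Ordinal.omega0 * (2 + α.1) + m < Ordinal.omega0 * (2 + α.1) + Ordinal.omega0 :=
        (add_lt_add_iff_left _).2 (Ordinal.natCast_lt_omega0 m)
    _ = Ordinal.omega0 * ((2 + α.1) + 1) := by rw [mul_add_one]
    _ ≤ Ordinal.omega0 * (2 + β.1) := by gcongr
    _ ≤ _ := le_self_add

theorem addNat_le_addNat {α : Set.Iio omegaOne.{u}} {m n : ℕ} :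
    addNat α m ≤ addNat α n ↔ m ≤ n := by
  change α.1 + (m : Ordinal) ≤ α.1 + n ↔ _
  simp

theorem addNat_blockStart_le {α β : Set.Iio omegaOne.{u}} {m n : ℕ}
    (h : addNat (blockStart α) m ≤ addNat (blockStart β) n) : α < β ∨ α = β ∧ m ≤ n := by
  rcases lt_trichotomy α β with h' | rfl | h'
  · exact .inl h'
  · exact .inr ⟨rfl, addNat_le_addNat.1 h⟩
  · exact absurd h (not_le.2 (addNat_blockStart_lt h' n m))

theorem addNat_blockStart_injective :
    Function.Injective fun p : Set.Iio omegaOne.{u} × ℕ => addNat (blockStart p.1) p.2 := by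
  rintro ⟨α, m⟩ ⟨β, n⟩ h
  rcases addNat_blockStart_le (le_of_eq h) with h1 | ⟨rfl, h1⟩
  · exact absurd h (addNat_blockStart_lt h1 m n).ne
  · exact Prod.ext rfl (le_antisymm h1 (addNat_le_addNat.1 (le_of_eq h.symm)))

/-- The moves that play every term of the reals `Y α` twice, from `ω * (2 + α)` on, and are as
given before that. -/
noncomputable def blockMoves (m : LongSeq.{u} ℕ) (Y : Set.Iio omegaOne.{u} → Baire) :
    LongSeq.{u} ℕ :=
  -- Each term is offered at both parities, so the player not bound to the strategy plays it exactly
  -- once, whichever player that is.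
  fun α => Function.extend (fun p : Set.Iio omegaOne.{u} × ℕ => addNat (blockStart p.1) p.2)
    (fun p => Y p.1 (p.2 / 2)) m α

theorem blockMoves_addNat (m : LongSeq.{u} ℕ) (Y : Set.Iio omegaOne.{u} → Baire)
    (α : Set.Iio omegaOne.{u}) (n : ℕ) :
    blockMoves m Y (addNat (blockStart α) n) = Y α (n / 2) :=
  addNat_blockStart_injective.extend_apply _ _ (α, n)

theorem blockMoves_of_lt {m : LongSeq.{u} ℕ} {Y : Set.Iio omegaOne.{u} → Baire}
    {α : Set.Iio omegaOne.{u}} (h : α < blockStart zeroPos) : blockMoves m Y α = m α := by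
  refine Function.extend_apply' _ _ _ ?_
  rintro ⟨⟨β, n⟩, rfl⟩
  refine absurd h (not_lt.2 ?_)
  change Ordinal.omega0 * (2 + 0) ≤ Ordinal.omega0 * (2 + β.1) + n
  refine le_trans ?_ le_self_add
  gcongr
  exact zero_le

theorem blockMoves_eq_or (m : LongSeq.{u} ℕ) (γ : Set.Iio omegaOne.{u}) :
    (∃ α n, addNat (blockStart α) n = γ) ∨ ∀ Y, blockMoves m Y γ = m γ := by
  by_cases h : ∃ α n, addNat (blockStart α) n = γ
  · exact .inl h
  · refine .inr fun Y => Function.extend_apply' _ _ _ ?_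
    rintro ⟨⟨β, n⟩, hp⟩
    exact h ⟨β, n, hp⟩

instance : Nonempty Baire := ⟨fun _ => 0⟩

/-- A real of given degree. -/
noncomputable def Degree.rep (d : Degree) : Baire := ofAntisymmetrization (· ≤ ·) d

theorem degree_rep (d : Degree) : degree (Degree.rep d) = d :=
  toAntisymmetrization_ofAntisymmetrization _ d

/-- A countable sequence of degrees, continued by a fixed degree. -/
noncomputable def extendSeq (s : CountableSeq.{u} Degree) : LongSeq.{u} Degree :=
  open scoped Classical in
  fun γ => if h : γ.1 < s.1.1 then s.2 ⟨γ.1, h⟩ else degree fun _ => 0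

theorem extendSeq_restrict (S : LongSeq.{u} Degree) {α γ : Set.Iio omegaOne.{u}} (h : γ < α) :
    extendSeq (S.restrict α) γ = S γ := dif_pos (show γ.1 < α.1 from h)

/-- The replies of the strategy in the block after a countable sequence of degrees, as a function
of the history of the real played by the other player. -/
noncomputable def blockReply (G : Set (Set.Iio omegaOne.{u})) (ρ : Strategy.{u})
    (m : LongSeq.{u} ℕ) (s : CountableSeq.{u} Degree) : Baire :=
  open scoped Classical in
  -- `c` codes a place in the block and a history of the opponent's real. Any real with that history
  -- gives the same reply at that place; `Classical.epsilon` picks one, an arbitrary real if there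
  -- is none.
  fun c => play G ρ (blockMoves m (Function.update (fun γ => (extendSeq s γ).rep) s.1
    (Classical.epsilon fun y => history y (Nat.unpair c).1 = (Nat.unpair c).2)))
      (addNat (blockStart s.1) (Nat.unpair c).1)

/-- Against any strategy, every sequence of degrees that grows fast enough is the sequence of
degrees of the blocks of a play, with given moves before `ω * 2`. -/
theorem blockDegrees_play (b : Prop) (ρ : Strategy.{u}) (m : LongSeq.{u} ℕ)
    {S : LongSeq.{u} Degree} (hS : GrowsFast (fun s => degree (blockReply (turn b) ρ m s)) S) :
    blockDegrees (play (turn b) ρ (blockMoves m fun γ => (S γ).rep)) = S := by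
  classical
  funext α
  have hα : blockReply (turn b) ρ m (S.restrict α) ≤ (S α).rep := by
    have := hS α
    rw [← degree_rep (S α)] at this
    exact this
  rw [blockDegrees, degree_eq_of_interleave (b := b) hα, degree_rep]
  · intro n hn
    have hmem : addNat (blockStart α) n ∈ turn b := addNat_blockStart_mem_turn.2 hn
    rw [blockReal, blockReply]
    simp only [Nat.unpair_pair]
    have hy : ∃ y : Baire, history y n = history (S α).rep n := ⟨_, rfl⟩
    have hε := Classical.epsilon_spec hy
    rw [history_eq_iff] at hε
    -- The actual play and the one inside `blockReply` have to agree only on the opponent's moves up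
    -- to place `n` of block `α`.
    refine play_congr fun γ hγ hγG => ?_
    rcases blockMoves_eq_or m γ with ⟨β, k, rfl⟩ | h
    · rw [blockMoves_addNat, blockMoves_addNat]
      rcases addNat_blockStart_le hγ with h | ⟨rfl, hk⟩
      · rw [Function.update_of_ne (show β ≠ (S.restrict α).1 from h.ne), extendSeq_restrict S h]
      · rw [show (S.restrict β).1 = β from rfl, Function.update_self]
        -- Here `k ≤ n`, and `k ≠ n` since place `n` belongs to the strategy. So `k / 2 < n`, where
        -- the chosen real agrees with the representative.
        refine (hε _ ?_).symm
        have : k ≠ n := by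
          rintro rfl
          exact hγG hmem
        omega
    · rw [h, h]
  · intro n hn
    have hmem : addNat (blockStart α) n ∉ turn b := addNat_blockStart_mem_turn.not.2 hn
    rw [blockReal, play_of_notMem hmem, blockMoves_addNat]

theorem play_blockMoves_of_lt (G : Set (Set.Iio omegaOne.{u})) (ρ : Strategy.{u})
    (m : LongSeq.{u} ℕ) (Y : Set.Iio omegaOne.{u} → Baire) {α : Set.Iio omegaOne.{u}}
    (h : α < blockStart zeroPos) : play G ρ (blockMoves m Y) α = play G ρ m α :=
  play_congr fun _ hγ _ => blockMoves_of_lt (hγ.trans_lt h)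

theorem addNat_zeroPos_lt_omegaPos (n : ℕ) : addNat (zeroPos.{u}) n < omegaPos := by
  change (0 : Ordinal) + n < Ordinal.omega0
  rw [zero_add]
  exact Ordinal.natCast_lt_omega0 n

theorem omegaPos_lt_sidePos : omegaPos.{u} < sidePos := by
  change Ordinal.omega0 < Ordinal.omega0 + 1
  exact lt_add_one _

theorem sidePos_lt_blockStart : sidePos.{u} < blockStart zeroPos := by
  change Ordinal.omega0 + 1 < Ordinal.omega0 * (2 + 0)
  rw [add_zero, ← one_add_one_eq_two, mul_add_one, mul_one]
  exact (add_lt_add_iff_left _).2 Ordinal.one_lt_omega0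

theorem firstReal_play_blockMoves (G : Set (Set.Iio omegaOne.{u})) (ρ : Strategy.{u})
    (m : LongSeq.{u} ℕ) (Y : Set.Iio omegaOne.{u} → Baire) :
    firstReal (play G ρ (blockMoves m Y)) = firstReal (play G ρ m) :=
  funext fun _ => play_blockMoves_of_lt G ρ m Y
    (((addNat_zeroPos_lt_omegaPos _).trans omegaPos_lt_sidePos).trans sidePos_lt_blockStart)

theorem exists_growsFast (f : CountableSeq.{u} Degree → Degree) : ∃ S, GrowsFast f S := by
  let S : LongSeq.{u} Degree := WellFoundedLT.fix fun α ih =>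
    f ⟨α, fun γ => ih ⟨γ.1, lt_trans (Set.mem_Iio.1 γ.2) (Set.mem_Iio.1 α.2)⟩ γ.2⟩
  refine ⟨S, fun α => le_of_eq ?_⟩
  conv_rhs => rw [show S = WellFoundedLT.fix _ from rfl, WellFoundedLT.fix_eq]
  rfl

/-! ### Constancy of truth on fast growing sequences -/

theorem GrowsFast.mono {f g : CountableSeq.{u} Degree → Degree} (h : ∀ s, f s ≤ g s)
    {S : LongSeq.{u} Degree} (hS : GrowsFast g S) : GrowsFast f S :=
  fun α => (h _).trans (hS α)

/-- The first player has no winning strategy, since the second player can choose either side. -/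
theorem not_exists_winning_first {δ : Ordinal.{u}} (hδ : omegaOne < δ)
    (φ : setLanguage.Formula (Fin 2)) :
    ¬ ∃ σ : Strategy.{u}, ∀ x, FollowsFirst σ x → x ∈ sidePayoff hδ φ := by
  classical
  rintro ⟨σ, hσ⟩
  -- `m i` answers `i` at `ω + 1`; only `0` and `1` matter in the end.
  let m : ℕ → LongSeq.{u} ℕ := fun i => Function.update (fun _ => 0) sidePos i
  let f : ℕ → CountableSeq.{u} Degree → Degree := fun i s =>
    degree (blockReply (turn True) σ (m i) s)
  -- One bound for all answers, so that the same `S` is realized whatever the side.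
  choose F hF using fun s => exists_degree_upper_bound fun i => f i s
  obtain ⟨S, hS⟩ := exists_growsFast F
  -- The real is completed before move `ω + 1`, hence does not depend on the side.
  have hr : ∀ i, firstReal (play (turn True) σ (m i)) = firstReal (play (turn True) σ (m 0)) :=
    fun i => funext fun n => play_congr fun γ hγ _ => by
      have : γ ≠ sidePos :=
        (hγ.trans_lt ((addNat_zeroPos_lt_omegaPos _).trans omegaPos_lt_sidePos)).ne
      simp [m, Function.update_of_ne this]
  have key : ∀ i, ¬ (i = 0 ↔ φ.Realize ![Level.real hδ (firstReal (play (turn True) σ (m 0))),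
      Level.degreeSeq hδ S]) := by
    intro i
    have h := hσ (play (turn True) σ (blockMoves (m i) fun γ => (S γ).rep)) fun α hα =>
      play_of_mem (iff_of_true hα trivial)
    rwa [sidePayoff, Set.mem_ofPred_eq, blockDegrees_play True σ (m i) (hS.mono fun s => hF s i),
      firstReal_play_blockMoves, hr, play_blockMoves_of_lt _ _ _ _ sidePos_lt_blockStart,
      play_of_notMem (by simp [sidePos_mem_turn]),
      show m i sidePos = i from Function.update_self ..] at h
  have h0 := key 0
  have h1 := key 1
  tauto

/-- The side chosen by `τ` is settled before the first block, hence the same for all `S`. -/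
theorem exists_truth_value_of_winning_second {δ : Ordinal.{u}} (hδ : omegaOne < δ)
    (φ : setLanguage.Formula (Fin 2)) (r : Baire) {τ : Strategy.{u}}
    (hτ : ∀ x, FollowsSecond τ x → x ∉ sidePayoff hδ φ) :
    ∃ (f : CountableSeq.{u} Degree → Degree) (v : Prop), ∀ S, GrowsFast f S →
      (φ.Realize ![Level.real hδ r, Level.degreeSeq hδ S] ↔ v) := by
  -- The first player spells `r` at the even places below `ω`; the value `0` elsewhere is
  -- immaterial.
  let m : LongSeq.{u} ℕ := Function.extend (fun n => addNat zeroPos (2 * n)) r fun _ => 0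
  refine ⟨fun s => degree (blockReply (turn False) τ m s), play (turn False) τ m sidePos = 0,
    fun S hS => ?_⟩
  have hr : firstReal (play (turn False) τ m) = r := funext fun n => by
    have hinj : Function.Injective fun n => addNat (zeroPos.{u}) (2 * n) := fun a b h => by
      have h1 := addNat_le_addNat.1 (le_of_eq h)
      have h2 := addNat_le_addNat.1 (le_of_eq h.symm)
      omega
    rw [firstReal, play_of_notMem (by simp [addNat_zeroPos_mem_turn])]
    exact hinj.extend_apply _ _ n
  have h := hτ (play (turn False) τ (blockMoves m fun γ => (S γ).rep)) fun α hα =>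
    play_of_mem (iff_of_false hα not_false)
  rw [sidePayoff, Set.mem_ofPred_eq, blockDegrees_play False τ m hS, firstReal_play_blockMoves,
    hr, play_blockMoves_of_lt _ _ _ _ sidePos_lt_blockStart, not_not] at h
  exact h.symm

/-- Makes the set of formulas countable, so that the functions found for single formulas have a
common bound. -/
instance : Countable setLanguage.Symbols := by
  have h1 : IsEmpty (Σ l, setLanguage.Functions l) := ⟨fun p => Empty.elim p.2⟩
  have h2 : Subsingleton (Σ l, setLanguage.Relations l) :=
    ⟨fun p q => by
      obtain ⟨_, _ | _⟩ := p
      obtain ⟨_, _ | _⟩ := q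
      rfl⟩
  have : Countable (Σ l, setLanguage.Functions l) := inferInstance
  have : Countable (Σ l, setLanguage.Relations l) := inferInstance
  exact inferInstanceAs (Countable (_ ⊕ _))

end LongGame

theorem theorem1
    (hdet : ∀ A : Set (LongGame.LongSeq.{u} ℕ),
      LongGame.OrdinalDefinable A → LongGame.Determined A)
    (δ : Ordinal.{u}) (hδ : LongGame.omegaOne.{u} < δ) (r : LongGame.Baire) :
    ∃ f : LongGame.CountableSeq.{u} LongGame.Degree → LongGame.Degree,
      ∀ φ : LongGame.setLanguage.Formula (Fin 2),
      ∀ S T : LongGame.LongSeq.{u} LongGame.Degree,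
        LongGame.GrowsFast f S → LongGame.GrowsFast f T →
        (φ.Realize ![LongGame.Level.real hδ r, LongGame.Level.degreeSeq hδ S] ↔
          φ.Realize ![LongGame.Level.real hδ r, LongGame.Level.degreeSeq hδ T]) := by
  have key : ∀ φ : LongGame.setLanguage.Formula (Fin 2),
      ∃ (f : LongGame.CountableSeq.{u} LongGame.Degree → LongGame.Degree) (v : Prop),
        ∀ S, LongGame.GrowsFast f S →
          (φ.Realize ![LongGame.Level.real hδ r, LongGame.Level.degreeSeq hδ S] ↔ v) := by
    intro φ
    rcases hdet _ (LongGame.ordinalDefinable_sidePayoff hδ φ) with h | ⟨τ, hτ⟩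
    · exact absurd h (LongGame.not_exists_winning_first hδ φ)
    · exact LongGame.exists_truth_value_of_winning_second hδ φ r hτ
  choose f v hfv using key
  -- Growing as fast as `F` prescribes implies growing as fast as each `f φ` prescribes.
  choose F hF using fun s => LongGame.exists_degree_upper_bound fun φ => f φ s
  exact ⟨F, fun φ S T hS hT =>
    (hfv φ S (hS.mono fun s => hF s φ)).trans (hfv φ T (hT.mono fun s => hF s φ)).symm⟩
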